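/- For a functor $F:\mathcal A\to\mathcal B$ between small categories, let $MF$ be the category whose objects are pairs $(A,\ x:B\cong FA)$ with $A$ an object of $\mathcal A$ and $x$ an isomorphism of $\mathcal B$, and whose arrows $(A,x:B\cong FA)\to(A',x':B'\cong FA')$ are pairs $(b:B\to B',\ a:A\to A')$ with $x'\circ b=Fa\circ x$. Let $LF:\mathcal A\to MF$, $A\mapsto(A,\mathrm{id}_{FA})$, and $RF:MF\to\mathcal B$, $(A,x:B\cong FA)\mapsto B$. Then $F\mapsto RF$ is the object part of an endofunctor $R$ of the arrow category $\mathbf{Cat}^{\mathbf 2}$, which is pointed by the natural transformation $\mathrm{Id}\to R$ with components $\eta_F=(LF,\mathrm{id}_{\mathcal B}):F\to RF$. The same formulas define a pointed endofunctor $R$ of $\mathbf{Gpd}^{\mathbf 2}$, where $\mathbf{Gpd}$ is the category of small groupoids. Let $R\text{-}\mathbf{Map}$ be the category of algebras for the pointed endofunctor: its objects are arrows $F$ with a structure map $s:RF\to F$ in the arrow category such that $s\circ\eta_F=\mathrm{id}_F$ (equivalently, normal cloven isofibrations), and its morphisms are the commutative squares that commute with the structure maps (equivalently, preserve the cleavages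 strictly). Sending an algebra to the codomain of its underlying functor gives functors $R\text{-}\mathbf{Map}\to\mathbf{Cat}$ and $R\text{-}\mathbf{Map}\to\mathbf{Gpd}$. A fibration $p:\mathcal E\to\mathcal C$ has finite products if $\mathcal C$ and all the fibres $\mathcal E_X$ have finite products and reindexing preserves them. Such a fibration is elementary if, for all objects $Y,X$ of $\mathcal C$, reindexing along the parametrised diagonal $\delta_{Y,X}=\langle \mathrm{pr}_1,\mathrm{pr}_2,\mathrm{pr}_2\rangle:Y\times X\to Y\times X\times X$ has a left adjoint $\Sigma_{Y,X}$, and these adjoints satisfy - Frobenius reciprocity: for all $A$ over $Y\times X$ and $B$ over $Y\times X\times X$ the canonical arrow $\Sigma_{Y,X}(\delta_{Y,X}^*B\wedge A)\to B\wedge\Sigma_{Y,X}A$ is an isomorphism; - the Beck–Chevalley condition: for every $f:Y\to Z$ and every $A$ over $Z\times X$ the canonical arrow $\Sigma_{Y,X}(f\times X)^*A\to(f\times X\times X)^*\Sigma_{Z,X}A$ is an isomorphism. **Corollary (R-Map fibrations not elementary).** The functors $R\text{-}\mathbf{Map}\to\mathbf{Cat}$ and $R\text{-}\mathbf{Map}\to\mathbf{Gpd}$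 are fibrations with finite products, and neither of them is elementary. -/

import Mathlib

open CategoryTheory CategoryTheory.Limits

/-! ### Fibrations with finite products and elementary fibrations -/

namespace FibProd

universe v₁ u₁ v₂ u₂

variable {B : Type u₁} [Category.{v₁} B] {E : Type u₂} [Category.{v₂} E]

open CategoryTheory.Functor.Fiber (fiberInclusion)

section Reindexing

variable (p : E ⥤ B) [p.IsFibered]

/-- The reindexed object `f^* A` in the fibre over `X`, for `f : X ⟶ Y` and `A` over `Y`. -/
noncomputable def reindexObj {X Y : B} (f : X ⟶ Y) (A : p.Fiber Y) : p.Fiber X :=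
  ⟨Functor.IsPreFibered.pullbackObj A.2 f, Functor.IsPreFibered.pullbackObj_proj A.2 f⟩

/-- The chosen cartesian lift `f^* A ⟶ A` of `f`. -/
noncomputable def lift {X Y : B} (f : X ⟶ Y) (A : p.Fiber Y) :
    fiberInclusion.obj (reindexObj p f A) ⟶ fiberInclusion.obj A :=
  Functor.IsPreFibered.pullbackMap A.2 f

instance lift_isCartesian {X Y : B} (f : X ⟶ Y) (A : p.Fiber Y) :
    p.IsCartesian f (lift p f A) :=
  Functor.IsPreFibered.pullbackMap.IsCartesian A.2 f

/-- An arrow `C ⟶ A` over `f` as a vertical arrow `C ⟶ f^* A`. -/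
noncomputable def toReindex {X Y : B} (f : X ⟶ Y) {C : p.Fiber X} {A : p.Fiber Y}
    (φ : fiberInclusion.obj C ⟶ fiberInclusion.obj A) [p.IsHomLift f φ] :
    C ⟶ reindexObj p f A :=
  let ψ : fiberInclusion.obj C ⟶ fiberInclusion.obj (reindexObj p f A) :=
    Functor.IsCartesian.map p f (lift p f A) φ
  have hψ : p.IsHomLift (𝟙 X) ψ := Functor.IsCartesian.map_isHomLift p f (lift p f A) φ
  ⟨ψ, hψ⟩

theorem toReindex_fac {X Y : B} (f : X ⟶ Y) {C : p.Fiber X} {A : p.Fiber Y}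
    (φ : fiberInclusion.obj C ⟶ fiberInclusion.obj A) [p.IsHomLift f φ] :
    fiberInclusion.map (toReindex p f φ) ≫ lift p f A = φ :=
  Functor.IsCartesian.fac p f (lift p f A) φ

theorem hom_ext_lift {X Y : B} (f : X ⟶ Y) {C : p.Fiber X} {A : p.Fiber Y}
    {φ ψ : C ⟶ reindexObj p f A}
    (h : fiberInclusion.map φ ≫ lift p f A = fiberInclusion.map ψ ≫ lift p f A) : φ = ψ :=
  Functor.Fiber.hom_ext (Functor.IsCartesian.ext p f (lift p f A) _ _ h)

/-- The reindexing functor `f^* : E_Y ⥤ E_X` along `f : X ⟶ Y`. -/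
noncomputable def reindex {X Y : B} (f : X ⟶ Y) : p.Fiber Y ⥤ p.Fiber X where
  obj A := reindexObj p f A
  map {A A'} φ := toReindex p f (lift p f A ≫ fiberInclusion.map φ)
  map_id A := by
    apply hom_ext_lift
    rw [toReindex_fac]
    simp
  map_comp φ ψ := by
    apply hom_ext_lift
    rw [toReindex_fac, Functor.map_comp, Functor.map_comp, Category.assoc, toReindex_fac,
      ← Category.assoc, ← Category.assoc, toReindex_fac]

end Reindexing

/-- A fibration with finite products: the base and all the fibres have finite products,
and the reindexing functors preserve them. -/
class IsFibrationWithProducts (p : E ⥤ B) : Prop extends p.IsFibered where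
  base : HasFiniteProducts B
  fiber : ∀ X : B, HasFiniteProducts (p.Fiber X)
  reindex : ∀ {X Y : B} (f : X ⟶ Y), PreservesFiniteProducts (reindex p f)

attribute [instance] IsFibrationWithProducts.fiber

/-- The parametrised diagonal `⟨pr₁, pr₂, pr₂⟩ : Y × X ⟶ Y × X × X`. -/
noncomputable def parDiag [HasFiniteProducts B] (Y X : B) : Y ⨯ X ⟶ (Y ⨯ X) ⨯ X :=
  prod.lift (𝟙 (Y ⨯ X)) prod.snd

/-- `f × X × X` commutes with the parametrised diagonals. -/
theorem parDiag_naturality [HasFiniteProducts B] {Y Z : B} (f : Y ⟶ Z) (X : B) :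
    prod.map f (𝟙 X) ≫ parDiag Z X = parDiag Y X ≫ prod.map (prod.map f (𝟙 X)) (𝟙 X) := by
  unfold parDiag
  ext <;> simp

section Canonical

variable (p : E ⥤ B)

/-- For a left adjoint `L` of `d^*`, the canonical arrow `L (d^* C ∧ A) ⟶ C ∧ L A`. -/
noncomputable def frobeniusHom [IsFibrationWithProducts p] {V W : B} {d : V ⟶ W}
    {L : p.Fiber V ⥤ p.Fiber W} (adj : L ⊣ reindex p d) (A : p.Fiber V) (C : p.Fiber W) :
    L.obj ((reindex p d).obj C ⨯ A) ⟶ C ⨯ L.obj A :=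
  prod.lift (L.map prod.fst ≫ adj.counit.app C) (L.map prod.snd)

variable [p.IsFibered]

/-- The arrow `a^* A ⟶ L' A` over `a ≫ d'` obtained by composing the cartesian lift of `a`,
the unit of `L' ⊣ d'^*` and the cartesian lift of `d'`. -/
noncomputable def beckChevalleyOver {V V' W' : B} (a : V ⟶ V') {d' : V' ⟶ W'}
    {L' : p.Fiber V' ⥤ p.Fiber W'} (adj' : L' ⊣ reindex p d') (A : p.Fiber V') :
    fiberInclusion.obj (reindexObj p a A) ⟶ fiberInclusion.obj (L'.obj A) :=
  lift p a A ≫ fiberInclusion.map (X := A) (Y := reindexObj p d' (L'.obj A)) (adj'.unit.app A) ≫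
    lift p d' (L'.obj A)

theorem beckChevalleyOver_isHomLift {V V' W W' : B} {a : V ⟶ V'} {d : V ⟶ W} {d' : V' ⟶ W'}
    {b : W ⟶ W'} (h : a ≫ d' = d ≫ b)
    {L' : p.Fiber V' ⥤ p.Fiber W'} (adj' : L' ⊣ reindex p d') (A : p.Fiber V') :
    p.IsHomLift (d ≫ b) (beckChevalleyOver p a adj' A) := by
  rw [← h]
  let η : A ⟶ reindexObj p d' (L'.obj A) := adj'.unit.app A
  have h₁ : p.IsHomLift d' (fiberInclusion.map η ≫ lift p d' (L'.obj A)) := inferInstance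
  exact IsHomLift.comp (p := p) a d' (lift p a A) (fiberInclusion.map η ≫ lift p d' (L'.obj A))

/-- For a commutative square `a ≫ d' = d ≫ b` in the base and left adjoints `L ⊣ d^*` and
`L' ⊣ d'^*`, the canonical arrow `L (a^* A) ⟶ b^* (L' A)`: the transpose of the composite
`a^* A ⟶ a^* (d'^* (L' A)) ≅ d^* (b^* (L' A))` of the reindexed unit with the
canonical isomorphism. -/
noncomputable def beckChevalleyHom {V V' W W' : B} {a : V ⟶ V'} {d : V ⟶ W} {d' : V' ⟶ W'}
    {b : W ⟶ W'} (h : a ≫ d' = d ≫ b)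
    {L : p.Fiber V ⥤ p.Fiber W} (adj : L ⊣ reindex p d)
    {L' : p.Fiber V' ⥤ p.Fiber W'} (adj' : L' ⊣ reindex p d') (A : p.Fiber V') :
    L.obj ((reindex p a).obj A) ⟶ (reindex p b).obj (L'.obj A) :=
  have _ := beckChevalleyOver_isHomLift p h adj' A
  (adj.homEquiv _ _).symm (toReindex p d (C := reindexObj p a A) (A := reindexObj p b (L'.obj A))
    (Functor.IsStronglyCartesian.map p b (lift p b (L'.obj A)) (g := d) rfl
      (beckChevalleyOver p a adj' A)))

end Canonical

/-- A fibration with products is elementary if reindexing along each parametrised diagonal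
has a left adjoint, and these left adjoints satisfy Frobenius reciprocity and the Beck-Chevalley
condition. -/
structure IsElementary (p : E ⥤ B) : Prop extends IsFibrationWithProducts p where
  exists_leftAdjoint :
    have := base
    ∃ (L : ∀ Y X : B, p.Fiber (Y ⨯ X) ⥤ p.Fiber ((Y ⨯ X) ⨯ X))
      (adj : ∀ Y X : B, L Y X ⊣ FibProd.reindex p (parDiag Y X)),
      (∀ (Y X : B) (A : p.Fiber (Y ⨯ X)) (C : p.Fiber ((Y ⨯ X) ⨯ X)),
        IsIso (frobeniusHom p (adj Y X) A C)) ∧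
      (∀ (Y Z X : B) (f : Y ⟶ Z) (A : p.Fiber (Z ⨯ X)),
        IsIso (beckChevalleyHom p (parDiag_naturality f X) (adj Y X) (adj Z X) A))

end FibProd

/-! ### Algebras for a pointed endofunctor -/

/-- The category of algebras for a pointed endofunctor `η : 𝟭 ⟶ R`: the algebras
`s : R A ⟶ A` with `η ≫ s = 𝟙`, with all the arrows that commute with the structure maps. -/
abbrev PointedAlgebra {C : Type*} [Category* C] {R : C ⥤ C} (η : 𝟭 C ⟶ R) :=
  ObjectProperty.FullSubcategory
    (fun A : Endofunctor.Algebra R => η.app A.a ≫ A.str = 𝟙 A.a)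

/-- The functor that sends an algebra for a pointed endofunctor on the category of arrows
of `C` to the codomain of its underlying arrow. -/
def pointedAlgebraCod {C : Type*} [Category* C] {R : Arrow C ⥤ Arrow C} (η : 𝟭 (Arrow C) ⟶ R) :
    PointedAlgebra η ⥤ C :=
  ObjectProperty.ι _ ⋙ Endofunctor.Algebra.forget R ⋙ Arrow.rightFunc

/-! ### The factorisation through the category of isomorphisms `b ≅ F a` -/

namespace IsoFact

universe v u

section

variable {A : Type u} [Category.{v} A] {B : Type u} [Category.{v} B]

/-- The objects of the category `M F`: an object `a` of `A`, an object `b` of `B`, and an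
isomorphism `b ≅ F a` in `B`. -/
structure M (F : A ⥤ B) : Type (max u v) where
  a : A
  b : B
  iso : b ≅ F.obj a

/-- The arrows of the category `M F`: pairs of an arrow of `B` and an arrow of `A` that make
the evident square commute. -/
@[ext]
structure M.Hom {F : A ⥤ B} (m m' : M F) where
  b : m.b ⟶ m'.b
  a : m.a ⟶ m'.a
  w : b ≫ m'.iso.hom = m.iso.hom ≫ F.map a

@[simps! id_a id_b comp_a comp_b]
instance (F : A ⥤ B) : Category.{v} (M F) where
  Hom m m' := M.Hom m m'
  id m := ⟨𝟙 _, 𝟙 _, by simp⟩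
  comp f g := ⟨f.b ≫ g.b, f.a ≫ g.a, by
    rw [Category.assoc, g.w, ← Category.assoc, f.w, Category.assoc, F.map_comp]⟩

@[ext]
theorem M.hom_ext {F : A ⥤ B} {m m' : M F} {f g : m ⟶ m'} (hb : f.b = g.b) (ha : f.a = g.a) :
    f = g :=
  M.Hom.ext hb ha

/-- The functor `L F : A ⥤ M F`, `a ↦ (a, id : F a ≅ F a)`. -/
@[simps]
def L (F : A ⥤ B) : A ⥤ M F where
  obj a := ⟨a, F.obj a, Iso.refl _⟩
  map f := ⟨F.map f, f, by simp⟩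

/-- The functor `R F : M F ⥤ B`, `(a, x : b ≅ F a) ↦ b`. -/
@[simps]
def R (F : A ⥤ B) : M F ⥤ B where
  obj m := m.b
  map f := f.b

theorem L_comp_R (F : A ⥤ B) : L F ⋙ R F = F := rfl

variable {A' : Type u} [Category.{v} A'] {B' : Type u} [Category.{v} B']

theorem square_obj {F : A ⥤ B} {G : A' ⥤ B'} {H : A ⥤ A'} {K : B ⥤ B'} (w : H ⋙ G = F ⋙ K)
    (a : A) : K.obj (F.obj a) = G.obj (H.obj a) :=
  (Functor.congr_obj w a).symm

theorem square_map {F : A ⥤ B} {G : A' ⥤ B'} {H : A ⥤ A'} {K : B ⥤ B'} (w : H ⋙ G = F ⋙ K)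
    {a a' : A} (f : a ⟶ a') : K.map (F.map f) ≫ eqToHom (square_obj w a') =
      eqToHom (square_obj w a) ≫ G.map (H.map f) := by
  have h : G.map (H.map f) = eqToHom (square_obj w a).symm ≫ K.map (F.map f) ≫
      eqToHom (square_obj w a') := Functor.congr_hom w f
  rw [h]
  simp

/-- The functor `M F ⥤ M G` induced by a commutative square of functors
`(H, K) : F ⟶ G`, sending `(a, x : b ≅ F a)` to `(H a, K x : K b ≅ K (F a) = G (H a))`. -/
@[simps]
def mapM {F : A ⥤ B} {G : A' ⥤ B'} (H : A ⥤ A') (K : B ⥤ B') (w : H ⋙ G = F ⋙ K) :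
    M F ⥤ M G where
  obj m := ⟨H.obj m.a, K.obj m.b,
    K.mapIso m.iso ≪≫ eqToIso (square_obj w m.a)⟩
  map {m m'} f := ⟨K.map f.b, H.map f.a, by
    have h := congrArg K.map f.w
    rw [Functor.map_comp, Functor.map_comp] at h
    simp only [Iso.trans_hom, Functor.mapIso_hom, eqToIso.hom, Category.assoc]
    rw [← square_map w, ← Category.assoc, h, Category.assoc]⟩

theorem M.ext_heq {F : A ⥤ B} {m m' : M F} (ha : m.a = m'.a) (hb : m.b = m'.b)
    (h : HEq m.iso.hom m'.iso.hom) : m = m' := by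
  obtain ⟨a, b, x⟩ := m
  obtain ⟨a', b', x'⟩ := m'
  dsimp at ha hb h
  subst ha hb
  rw [Iso.ext (eq_of_heq h)]

theorem M.hom_heq {F : A ⥤ B} {m₁ m₁' m₂ m₂' : M F} (h₁ : m₁ = m₂) (h₂ : m₁' = m₂')
    (f : m₁ ⟶ m₁') (g : m₂ ⟶ m₂') (hb : HEq f.b g.b) (ha : HEq f.a g.a) : HEq f g := by
  subst h₁ h₂
  exact heq_of_eq (M.hom_ext (eq_of_heq hb) (eq_of_heq ha))

theorem functor_hext {C : Type*} [Category* C] {F : A ⥤ B} {P Q : C ⥤ M F}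
    (ha : ∀ c, (P.obj c).a = (Q.obj c).a) (hb : ∀ c, (P.obj c).b = (Q.obj c).b)
    (hx : ∀ c, HEq (P.obj c).iso.hom (Q.obj c).iso.hom)
    (hma : ∀ {c d : C} (f : c ⟶ d), HEq (P.map f).a (Q.map f).a)
    (hmb : ∀ {c d : C} (f : c ⟶ d), HEq (P.map f).b (Q.map f).b) : P = Q :=
  have h : ∀ c, P.obj c = Q.obj c := fun c => M.ext_heq (ha c) (hb c) (hx c)
  Functor.hext h (fun c d f => M.hom_heq (h c) (h d) _ _ (hmb f) (hma f))

theorem mapM_id (F : A ⥤ B) (w : 𝟭 A ⋙ F = F ⋙ 𝟭 B) : mapM (𝟭 A) (𝟭 B) w = 𝟭 (M F) :=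
  functor_hext (fun _ => rfl) (fun _ => rfl) (fun m => heq_of_eq (by
      change m.iso.hom ≫ eqToHom (square_obj w m.a) = m.iso.hom
      simp))
    (fun _ => HEq.rfl) (fun _ => HEq.rfl)

theorem mapM_comp {A'' : Type u} [Category.{v} A''] {B'' : Type u} [Category.{v} B'']
    {F : A ⥤ B} {F' : A' ⥤ B'} {F'' : A'' ⥤ B''} (H : A ⥤ A') (K : B ⥤ B')
    (w : H ⋙ F' = F ⋙ K) (H' : A' ⥤ A'') (K' : B' ⥤ B'') (w' : H' ⋙ F'' = F' ⋙ K')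
    (w'' : (H ⋙ H') ⋙ F'' = F ⋙ (K ⋙ K')) :
    mapM (H ⋙ H') (K ⋙ K') w'' = mapM H K w ⋙ mapM H' K' w' :=
  functor_hext (fun _ => rfl) (fun _ => rfl) (fun m => heq_of_eq (by
      change K'.map (K.map m.iso.hom) ≫ eqToHom (square_obj w'' m.a) =
        K'.map (K.map m.iso.hom ≫ eqToHom (square_obj w m.a)) ≫ eqToHom (square_obj w' (H.obj m.a))
      simp [eqToHom_map]))
    (fun _ => HEq.rfl) (fun _ => HEq.rfl)

theorem L_naturality {F : A ⥤ B} {G : A' ⥤ B'} (H : A ⥤ A') (K : B ⥤ B')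
    (w : H ⋙ G = F ⋙ K) : H ⋙ L G = L F ⋙ mapM H K w := by
  have key : ∀ {c d : B'} (e : c = d), HEq (𝟙 c) (eqToHom e.symm) := by
    rintro c _ rfl; rfl
  refine functor_hext (fun _ => rfl) (fun a => Functor.congr_obj w a) (fun a => ?_)
    (fun _ => HEq.rfl) (fun f => Functor.hcongr_hom w f)
  have h : ((L F ⋙ mapM H K w).obj a).iso.hom = eqToHom (square_obj w a) := by
    change K.map (𝟙 (F.obj a)) ≫ eqToHom (square_obj w a) = _
    simp
  rw [h]
  exact key (Functor.congr_obj w a)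

end

section

variable {A : Type u} [Groupoid.{v} A] {B : Type u} [Groupoid.{v} B]

/-- `M F` is a groupoid when `F` is a functor between groupoids. -/
instance groupoidM (F : A ⥤ B) : Groupoid.{v} (M F) where
  inv {m m'} f := ⟨Groupoid.inv f.b, Groupoid.inv f.a, by
    rw [Groupoid.inv_eq_inv, Groupoid.inv_eq_inv, IsIso.inv_comp_eq, ← Category.assoc, f.w]
    simp⟩
  inv_comp f := by ext <;> simp
  comp_inv f := by ext <;> simp

end

end IsoFact

/-! ### The pointed endofunctor on arrows of `Cat` and of `Grpd`, and its algebras -/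

universe u

namespace CatR

/-- The endofunctor `F ↦ R F` on the arrow category of `Cat`. -/
def R : Arrow Cat.{u, u} ⥤ Arrow Cat.{u, u} where
  obj F := Arrow.mk (IsoFact.R F.hom.toFunctor).toCatHom
  map {F G} φ := Arrow.homMk
    (IsoFact.mapM φ.left.toFunctor φ.right.toFunctor
      (congrArg Cat.Hom.toFunctor φ.w)).toCatHom φ.right rfl
  map_id F := by
    apply Arrow.hom_ext
    · exact congrArg Functor.toCatHom (IsoFact.mapM_id F.hom.toFunctor rfl)
    · rfl
  map_comp φ ψ := by
    apply Arrow.hom_ext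
    · exact congrArg Functor.toCatHom (IsoFact.mapM_comp _ _ (congrArg Cat.Hom.toFunctor φ.w)
        _ _ (congrArg Cat.Hom.toFunctor ψ.w) (congrArg Cat.Hom.toFunctor (φ ≫ ψ).w))
    · rfl

/-- The unit `(L F, id) : F ⟶ R F`. -/
def unit : 𝟭 (Arrow Cat.{u, u}) ⟶ R where
  app F := Arrow.homMk (IsoFact.L F.hom.toFunctor).toCatHom (𝟙 F.right) rfl
  naturality F G φ := by
    apply Arrow.hom_ext
    · exact congrArg Functor.toCatHom (IsoFact.L_naturality _ _ (congrArg Cat.Hom.toFunctor φ.w))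
    · rfl

end CatR

namespace GrpdR

/-- The endofunctor `F ↦ R F` on the arrow category of `Grpd`. -/
def R : Arrow Grpd.{u, u} ⥤ Arrow Grpd.{u, u} where
  obj F := Arrow.mk (X := Grpd.of (IsoFact.M F.hom)) (Y := F.right) (IsoFact.R F.hom)
  map {F G} φ := Arrow.homMk (IsoFact.mapM φ.left φ.right φ.w) φ.right rfl
  map_id F := by
    apply Arrow.hom_ext
    · exact IsoFact.mapM_id F.hom rfl
    · rfl
  map_comp φ ψ := by
    apply Arrow.hom_ext
    · exact IsoFact.mapM_comp _ _ φ.w _ _ ψ.w (φ ≫ ψ).w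
    · rfl

/-- The unit `(L F, id) : F ⟶ R F`. -/
def unit : 𝟭 (Arrow Grpd.{u, u}) ⟶ R where
  app F := 
    let l : F.left ⟶ (R.obj F).left := IsoFact.L F.hom
    let r : F.right ⟶ (R.obj F).right := 𝟙 F.right
    (Arrow.homMk l r rfl : F ⟶ R.obj F)
  naturality F G φ := by
    apply Arrow.hom_ext
    · exact IsoFact.L_naturality _ _ φ.w
    · rfl

end GrpdR

/-! Everything is proved for a pointed endofunctor `η : 𝟭 ⟶ R` of an arrow category whose components
are invertible on codomains. The unit law then forces the codomain part of a structure map, so an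
algebra is an arrow with extra structure on its domain only.

Fibration with products: the pullback of an algebra along an arrow of the base, and the fibre
product of two algebras over the same object, carry componentwise structure maps. Compatibility with
them can be tested on the projections, which are jointly monic. The products so obtained are
universal over all arrows of the base, hence stable under reindexing.

Not elementary: an algebra lifts paths (isomorphisms) of its base from a given point over one end.
Algebra morphisms preserve these lifts, and by normality a constant path lifts to the given point.
Nothing makes the cleavage functorial, so distinct points `a`, `b` over one end of the interval may
have the same lift over the other end. A left adjoint `L` along a single diagonal with Frobenius
reciprocity excludes this. Frobenius extends the evident map from the diagonal to a transport `T`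
from `π₁^* A ∧ L K` to `A` over `π₂` (`exists_transport`). The path `t ↦ ((i₁, t), i₁)` is on the
diagonal at `i₁`; its image under `π₁` is the whole interval, and under `π₂` it is constant. Take
the points of `π₁^* A ∧ L K` given by `a` and by `b` with a common second component, and lift them
along this path. The lifts agree in both components, so they are equal; but `T` preserves lifts and
sees a constant path, so it sends them to `a` and `b`. Hence `a = b`
(`PathLifting.not_isElementary`).

The counterexample is a map of indiscrete groupoids from three points to two, with a normal cleavage
that sends both points of the larger fibre to the single point of the other. -/

namespace FibProd

universe v₁ u₁ v₂ u₂

variable {B : Type u₁} [Category.{v₁} B] {E : Type u₂} [Category.{v₂} E]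

open CategoryTheory.Functor.Fiber (fiberInclusion)

/-! ### Fibred terminal objects and products -/

/-- An object `T` over `X` such that every arrow `f` to `X` lifts uniquely to an arrow to `T`. -/
def IsFibredTerminal (p : E ⥤ B) {X : B} (T : p.Fiber X) : Prop :=
  ∀ ⦃Y : B⦄ (f : Y ⟶ X) (Z : p.Fiber Y), ∃! φ : Z.1 ⟶ T.1, p.IsHomLift f φ

/-- A cone over two objects of a fibre that is universal among pairs of arrows over any common
arrow of the base. -/
structure IsFibredProduct (p : E ⥤ B) {X : B} {A₁ A₂ W : p.Fiber X} (π₁ : W ⟶ A₁) (π₂ : W ⟶ A₂) :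
    Prop where
  existsUnique : ∀ ⦃Y : B⦄ (f : Y ⟶ X) (Z : p.Fiber Y) (α₁ : Z.1 ⟶ A₁.1) (α₂ : Z.1 ⟶ A₂.1),
    p.IsHomLift f α₁ → p.IsHomLift f α₂ →
      ∃! γ : Z.1 ⟶ W.1, p.IsHomLift f γ ∧ γ ≫ π₁.1 = α₁ ∧ γ ≫ π₂.1 = α₂

section

variable {p : E ⥤ B}

theorem IsFibredTerminal.nonempty_isTerminal {X : B} {T : p.Fiber X} (hT : IsFibredTerminal p T) :
    Nonempty (IsTerminal T) := by
  choose φ hφ huniq using fun Z => hT (𝟙 X) Z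
  exact ⟨IsTerminal.ofUniqueHom (fun Z => ⟨φ Z, hφ Z⟩)
    (fun Z m => Subtype.ext (huniq Z m.1 m.2))⟩

theorem IsFibredProduct.nonempty_isLimit {X : B} {A₁ A₂ W : p.Fiber X} {π₁ : W ⟶ A₁} {π₂ : W ⟶ A₂}
    (h : IsFibredProduct p π₁ π₂) : Nonempty (IsLimit (BinaryFan.mk π₁ π₂)) := by
  choose γ hγ huniq using fun (Z : p.Fiber X) (α₁ : Z ⟶ A₁) (α₂ : Z ⟶ A₂) =>
    h.existsUnique (𝟙 X) Z α₁.1 α₂.1 α₁.2 α₂.2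
  exact ⟨BinaryFan.IsLimit.mk _ (fun {Z} α₁ α₂ => ⟨γ Z α₁ α₂, (hγ Z α₁ α₂).1⟩)
    (fun {Z} α₁ α₂ => Subtype.ext (hγ Z α₁ α₂).2.1)
    (fun {Z} α₁ α₂ => Subtype.ext (hγ Z α₁ α₂).2.2)
    (fun {Z} α₁ α₂ m h₁ h₂ => Subtype.ext (huniq Z α₁ α₂ m.1
      ⟨m.2, congrArg Subtype.val h₁, congrArg Subtype.val h₂⟩))⟩

end

instance isHomLift_val {p : E ⥤ B} {X : B} {A A' : p.Fiber X} (φ : A ⟶ A') :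
    p.IsHomLift (𝟙 X) φ.1 :=
  φ.2

theorem comp_val {p : E ⥤ B} {X : B} {A A' A'' : p.Fiber X} (φ : A ⟶ A') (ψ : A' ⟶ A'') :
    (φ ≫ ψ).1 = φ.1 ≫ ψ.1 :=
  rfl

section

variable {p : E ⥤ B} [p.IsFibered]

/-- The cartesian lift of `f`, as an arrow out of the value of the reindexing functor. -/
noncomputable def cartLift {X Y : B} (f : X ⟶ Y) (A : p.Fiber Y) :
    ((reindex p f).obj A).1 ⟶ A.1 :=
  lift p f A

instance isCartesian_cartLift {X Y : B} (f : X ⟶ Y) (A : p.Fiber Y) :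
    p.IsCartesian f (cartLift f A) :=
  lift_isCartesian p f A

theorem reindex_map_cartLift {X Y : B} (f : X ⟶ Y) {A A' : p.Fiber Y} (φ : A ⟶ A') :
    ((reindex p f).map φ).1 ≫ cartLift f A' = cartLift f A ≫ φ.1 :=
  have : p.IsHomLift f (lift p f A ≫ fiberInclusion.map φ) :=
    IsHomLift.comp_lift_id_right p f (lift p f A) (fiberInclusion.map φ)
  toReindex_fac p f (A := A') _

/-- Arrows over `g` into `f^* T` are the same as arrows over `g ≫ f` into `T`, because cartesian
lifts in a fibration are strongly cartesian. The case of products below rests on the same fact. -/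
theorem IsFibredTerminal.reindex {X Y : B} {T : p.Fiber Y} (hT : IsFibredTerminal p T)
    (f : X ⟶ Y) : IsFibredTerminal p ((reindex p f).obj T) := by
  intro V g Z
  obtain ⟨φ, hφ, huniq⟩ := hT (g ≫ f) Z
  dsimp only at hφ huniq
  exact ⟨Functor.IsStronglyCartesian.map p f (cartLift f T) (g := g) rfl φ, inferInstance,
    fun ψ hψ => Functor.IsStronglyCartesian.map_uniq p f (cartLift f T) rfl φ ψ
      (huniq _ (IsHomLift.comp p g f ψ (cartLift f T)))⟩

theorem IsFibredProduct.reindex {X Y : B} {A₁ A₂ W : p.Fiber Y} {π₁ : W ⟶ A₁} {π₂ : W ⟶ A₂}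
    (h : IsFibredProduct p π₁ π₂) (f : X ⟶ Y) :
    IsFibredProduct p ((reindex p f).map π₁) ((reindex p f).map π₂) := by
  constructor
  intro V g Z α₁ α₂ h₁ h₂
  obtain ⟨φ, ⟨hφ, hφ₁, hφ₂⟩, huniq⟩ := h.existsUnique (g ≫ f) Z
    (α₁ ≫ cartLift f A₁) (α₂ ≫ cartLift f A₂) inferInstance inferInstance
  let γ := Functor.IsStronglyCartesian.map p f (cartLift f W) (g := g) rfl φ
  have fac : γ ≫ cartLift f W = φ := Functor.IsStronglyCartesian.fac p f (cartLift f W) rfl φ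
  refine ⟨γ, ⟨inferInstance, ?_, ?_⟩, ?_⟩
  · apply Functor.IsStronglyCartesian.ext p f (cartLift f A₁) g
    rw [Category.assoc, reindex_map_cartLift, reassoc_of% fac, hφ₁]
  · apply Functor.IsStronglyCartesian.ext p f (cartLift f A₂) g
    rw [Category.assoc, reindex_map_cartLift, reassoc_of% fac, hφ₂]
  · rintro ψ ⟨hψ, hψ₁, hψ₂⟩
    apply Functor.IsStronglyCartesian.ext p f (cartLift f W) g
    rw [fac]
    refine huniq _ ⟨inferInstance, ?_, ?_⟩
    · rw [Category.assoc, ← reindex_map_cartLift, reassoc_of% hψ₁]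
    · rw [Category.assoc, ← reindex_map_cartLift, reassoc_of% hψ₂]

/-- Preservation of a limit need only be checked on one limit cone; for a fibred terminal object or
product, the reindexed cone is again fibred, hence limiting. -/
theorem isFibrationWithProducts_of_fibred [HasFiniteProducts B]
    (hT : ∀ X : B, ∃ T : p.Fiber X, IsFibredTerminal p T)
    (hP : ∀ (X : B) (A₁ A₂ : p.Fiber X), ∃ (W : p.Fiber X) (π₁ : W ⟶ A₁) (π₂ : W ⟶ A₂),
      IsFibredProduct p π₁ π₂) : IsFibrationWithProducts p where
  base := inferInstance
  fiber X := by
    obtain ⟨T, hT⟩ := hT X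
    have : HasTerminal (p.Fiber X) := hT.nonempty_isTerminal.some.hasTerminal
    have : HasBinaryProducts (p.Fiber X) := by
      have (A₁ A₂ : p.Fiber X) : HasLimit (pair A₁ A₂) := by
        obtain ⟨W, π₁, π₂, h⟩ := hP X A₁ A₂
        exact ⟨⟨⟨_, h.nonempty_isLimit.some⟩⟩⟩
      exact hasBinaryProducts_of_hasLimit_pair _
    exact hasFiniteProducts_of_has_binary_and_terminal
  reindex {X Y} f := by
    obtain ⟨T, hT⟩ := hT Y
    have hlim : ∀ A₁ A₂ : p.Fiber Y, HasLimit (pair A₁ A₂) := fun A₁ A₂ => by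
      obtain ⟨W, π₁, π₂, h⟩ := hP Y A₁ A₂
      exact ⟨⟨⟨_, h.nonempty_isLimit.some⟩⟩⟩
    have : HasTerminal (p.Fiber Y) := hT.nonempty_isTerminal.some.hasTerminal
    have : HasBinaryProducts (p.Fiber Y) := hasBinaryProducts_of_hasLimit_pair _
    have : HasFiniteProducts (p.Fiber Y) := hasFiniteProducts_of_has_binary_and_terminal
    have : PreservesLimit (Functor.empty.{0} (p.Fiber Y)) (FibProd.reindex p f) :=
      preservesLimit_of_preserves_limit_cone hT.nonempty_isTerminal.some
        ((isLimitMapConeEmptyConeEquiv _ _).symm (hT.reindex f).nonempty_isTerminal.some)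
    have : PreservesLimitsOfShape (Discrete PEmpty.{1}) (FibProd.reindex p f) :=
      preservesLimitsOfShape_pempty_of_preservesTerminal _
    have : PreservesLimitsOfShape (Discrete WalkingPair) (FibProd.reindex p f) := by
      have (A₁ A₂ : p.Fiber Y) : PreservesLimit (pair A₁ A₂) (FibProd.reindex p f) := by
        obtain ⟨W, π₁, π₂, h⟩ := hP Y A₁ A₂
        exact preservesLimit_of_preserves_limit_cone h.nonempty_isLimit.some
          ((isLimitMapConeBinaryFanEquiv _ _ _).symm (h.reindex f).nonempty_isLimit.some)
      exact ⟨fun {K} => preservesLimit_of_iso_diagram _ (diagramIsoPair K).symm⟩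
    exact PreservesFiniteProducts.of_preserves_binary_and_terminal _

end

/-! ### Transport from Frobenius reciprocity -/

section Transport

variable {p : E ⥤ B} [IsFibrationWithProducts p]

/-- The first projection of a product in a fibre, as an arrow of the total category. -/
noncomputable abbrev fstVal {X : B} (A A' : p.Fiber X) : (A ⨯ A').1 ⟶ A.1 :=
  (prod.fst : A ⨯ A' ⟶ A).1

/-- The second projection of a product in a fibre, as an arrow of the total category. -/
noncomputable abbrev sndVal {X : B} (A A' : p.Fiber X) : (A ⨯ A').1 ⟶ A'.1 :=
  (prod.snd : A ⨯ A' ⟶ A').1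

/-- If Frobenius reciprocity holds for `L ⊣ d^*`, then an object `A` reindexed along `π₁` can be
transported, over `L K`, to `A` reindexed along `π₂`, for arrows `π₁` and `π₂` that agree
on `d`. -/
theorem exists_transport {V W Z : B} {d : V ⟶ W} {π₁ π₂ : W ⟶ Z} (h : d ≫ π₁ = d ≫ π₂)
    {L : p.Fiber V ⥤ p.Fiber W} (adj : L ⊣ reindex p d) (A : p.Fiber Z) (K : p.Fiber V)
    [IsIso (frobeniusHom p adj K ((reindex p π₁).obj A))] :
    ∃ (e : ((reindex p d).obj ((reindex p π₁).obj A) ⨯ K).1 ⟶ ((reindex p π₁).obj A ⨯ L.obj K).1)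
      (s : K.1 ⟶ (L.obj K).1) (T : ((reindex p π₁).obj A ⨯ L.obj K).1 ⟶ A.1),
      p.IsHomLift d e ∧ p.IsHomLift d s ∧ p.IsHomLift π₂ T ∧
      e ≫ fstVal _ _ = fstVal _ _ ≫ cartLift d ((reindex p π₁).obj A) ∧
      e ≫ sndVal _ _ = sndVal _ _ ≫ s ∧
      e ≫ T = fstVal _ _ ≫ cartLift d ((reindex p π₁).obj A) ≫ cartLift π₁ A := by
  let C := (reindex p π₁).obj A
  let D := (reindex p π₂).obj A
  let U := (reindex p d).obj C ⨯ K
  let F := frobeniusHom p adj K C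
  -- On `d` the two arrows `π₁` and `π₂` agree, so this composite also lies over `d ≫ π₂`. It
  -- factors through `π₂^* A`, then through `d^* (π₂^* A)`; the vertical factor `φ` transposes to `L
  -- U ⟶ π₂^* A`.
  let κ : U.1 ⟶ A.1 :=
    fstVal _ _ ≫ cartLift d C ≫ cartLift π₁ A
  have hκ : p.IsHomLift (d ≫ π₂) κ := by
    rw [← h]
    infer_instance
  let κ' : U.1 ⟶ D.1 :=
    Functor.IsStronglyCartesian.map p π₂ (cartLift π₂ A) (g := d) rfl κ
  have facκ : κ' ≫ cartLift π₂ A = κ :=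
    Functor.IsStronglyCartesian.fac p π₂ (cartLift π₂ A) rfl κ
  let φ : U ⟶ (reindex p d).obj D :=
    ⟨Functor.IsCartesian.map p d (cartLift d D) κ', inferInstance⟩
  have facφ : φ.1 ≫ cartLift d D = κ' := Functor.IsCartesian.fac p d (cartLift d D) κ'
  -- The universal arrow `U ⟶ L U` over `d`, followed by the Frobenius arrow. By `he`, composing `e`
  -- with a vertical arrow `m` amounts to transposing `F ≫ m`.
  let e : U.1 ⟶ (C ⨯ L.obj K).1 := (adj.unit.app U).1 ≫ cartLift d (L.obj U) ≫ F.1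
  have he {D : p.Fiber W} (m : C ⨯ L.obj K ⟶ D) :
      e ≫ m.1 = (adj.unit.app U ≫ (reindex p d).map (F ≫ m)).1 ≫ cartLift d D := by
    simp only [e, comp_val, Category.assoc, reindex_map_cartLift, Functor.id_obj, Functor.comp_obj]
  have unit_map {D : p.Fiber W} (m : L.obj U ⟶ D) :
      adj.unit.app U ≫ (reindex p d).map m = adj.homEquiv U D m :=
    (adj.homEquiv_unit U D m).symm
  have h₁ : adj.unit.app U ≫ (reindex p d).map (F ≫ prod.fst) = prod.fst := by
    rw [show F ≫ prod.fst = L.map prod.fst ≫ adj.counit.app C from prod.lift_fst _ _, unit_map]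
    exact (congrArg _ (adj.homEquiv_counit _ _ _).symm).trans (Equiv.apply_symm_apply _ _)
  have h₂ : adj.unit.app U ≫ (reindex p d).map (F ≫ prod.snd) = prod.snd ≫ adj.unit.app K := by
    rw [show F ≫ prod.snd = L.map prod.snd from prod.lift_snd _ _]
    exact adj.unit_naturality _
  -- Only here is the Frobenius arrow inverted: it turns the transpose of `φ` into an arrow out of
  -- `C ⨯ L K`.
  have h₃ : adj.unit.app U ≫ (reindex p d).map (F ≫ inv F ≫ (adj.homEquiv _ _).symm φ) = φ := by
    rw [IsIso.hom_inv_id_assoc, unit_map]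
    exact Equiv.apply_symm_apply _ _
  refine ⟨e, (adj.unit.app K).1 ≫ cartLift d (L.obj K),
    (inv F ≫ (adj.homEquiv _ _).symm φ).1 ≫ cartLift π₂ A, ?_, ?_, ?_, ?_, ?_, ?_⟩
  · exact inferInstanceAs (p.IsHomLift d ((adj.unit.app U).1 ≫ cartLift d (L.obj U) ≫ F.1))
  · exact IsHomLift.comp_lift_id_left p d (cartLift d (L.obj K)) (adj.unit.app K).1
  · infer_instance
  · exact (he _).trans (congrArg (fun m => Subtype.val m ≫ cartLift d C) h₁)
  · exact ((he _).trans (congrArg (fun m => Subtype.val m ≫ cartLift d (L.obj K)) h₂)).trans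
      (Category.assoc _ _ _)
  · exact (Category.assoc _ _ _).symm.trans
      ((congrArg (· ≫ cartLift π₂ A) ((he _).trans
        ((congrArg (fun m => Subtype.val m ≫ cartLift d D) h₃).trans facφ))).trans facκ)

end Transport

end FibProd

/-! ### Algebras in a fibre, described by their domains -/

namespace PointedAlgebraFibre

open FibProd

universe v w

variable {C : Type w} [Category.{v} C] {R : Arrow C ⥤ Arrow C} {η : 𝟭 (Arrow C) ⟶ R}

/-- The underlying arrow of an algebra. -/
abbrev carrier {X : C} (A : (pointedAlgebraCod η).Fiber X) : Arrow C := A.1.obj.a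

/-- The domain of the underlying arrow of an algebra over `X`. -/
abbrev left {X : C} (A : (pointedAlgebraCod η).Fiber X) : C := (carrier A).left

/-- The codomain of the underlying arrow of an algebra over `X` is `X`. -/
def baseIso {X : C} (A : (pointedAlgebraCod η).Fiber X) : (carrier A).right ≅ X :=
  eqToIso A.2

/-- The underlying arrow of an algebra over `X`, as an arrow to `X`. -/
def proj {X : C} (A : (pointedAlgebraCod η).Fiber X) : left A ⟶ X :=
  (carrier A).hom ≫ (baseIso A).hom

/-- The domain part of the structure map of an algebra. -/
def strLeft {X : C} (A : (pointedAlgebraCod η).Fiber X) : (R.obj (carrier A)).left ⟶ left A :=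
  A.1.obj.str.left

/-- The domain part of a morphism of algebras. -/
def homLeft {X Y : C} {A : (pointedAlgebraCod η).Fiber X} {B : (pointedAlgebraCod η).Fiber Y}
    (φ : A.1 ⟶ B.1) : left A ⟶ left B :=
  φ.hom.f.left

/-- A commutative square between the underlying arrows of two algebras. -/
def square {X Y : C} {A : (pointedAlgebraCod η).Fiber X} {B : (pointedAlgebraCod η).Fiber Y}
    (f : X ⟶ Y) (l : left A ⟶ left B) (h : l ≫ proj B = proj A ≫ f) : carrier A ⟶ carrier B :=
  Arrow.homMk l ((baseIso A).hom ≫ f ≫ (baseIso B).inv) (by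
    have h' := h =≫ (baseIso B).inv
    simpa [proj] using h')

theorem homLeft_comp {X Y Z : C} {A : (pointedAlgebraCod η).Fiber X}
    {B : (pointedAlgebraCod η).Fiber Y} {D : (pointedAlgebraCod η).Fiber Z}
    (φ : A.1 ⟶ B.1) (ψ : B.1 ⟶ D.1) :
    homLeft (A := A) (B := D) (φ ≫ ψ) = homLeft φ ≫ homLeft ψ :=
  rfl

theorem unit_strLeft {X : C} (A : (pointedAlgebraCod η).Fiber X) :
    (η.app (carrier A)).left ≫ strLeft A = 𝟙 (left A) :=
  congrArg CommaMorphism.left A.1.property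

theorem homLeft_proj {X Y : C} {A : (pointedAlgebraCod η).Fiber X}
    {B : (pointedAlgebraCod η).Fiber Y} (f : X ⟶ Y) (φ : A.1 ⟶ B.1)
    [h : (pointedAlgebraCod η).IsHomLift f φ] : homLeft φ ≫ proj B = proj A ≫ f := by
  obtain ⟨A, rfl⟩ := A
  obtain ⟨B, rfl⟩ := B
  obtain rfl := IsHomLift.eq_of_isHomLift _ f φ
  have hw : φ.hom.f.left ≫ B.obj.a.hom = A.obj.a.hom ≫ φ.hom.f.right := φ.hom.f.w
  exact ((congrArg _ (Category.comp_id _)).trans hw).trans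
    (congrArg (· ≫ _) (Category.comp_id _).symm)

theorem hom_eq_square {X Y : C} {A : (pointedAlgebraCod η).Fiber X}
    {B : (pointedAlgebraCod η).Fiber Y} (f : X ⟶ Y) (φ : A.1 ⟶ B.1)
    [h : (pointedAlgebraCod η).IsHomLift f φ] :
    φ.hom.f = square f (homLeft φ) (homLeft_proj f φ) := by
  apply Arrow.hom_ext
  · rfl
  · exact IsHomLift.fac' (pointedAlgebraCod η) f φ

theorem hom_ext_of_homLeft {X Y : C} {A : (pointedAlgebraCod η).Fiber X}
    {B : (pointedAlgebraCod η).Fiber Y} (f : X ⟶ Y) {φ ψ : A.1 ⟶ B.1}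
    [(pointedAlgebraCod η).IsHomLift f φ] [(pointedAlgebraCod η).IsHomLift f ψ]
    (h : homLeft φ = homLeft ψ) : φ = ψ := by
  apply ObjectProperty.hom_ext
  apply Endofunctor.Algebra.ext
  rw [hom_eq_square f φ, hom_eq_square f ψ]
  congr 1

/-- A morphism of algebras over `f` from a map between the domains. -/
def mkHom {X Y : C} {A : (pointedAlgebraCod η).Fiber X} {B : (pointedAlgebraCod η).Fiber Y}
    (f : X ⟶ Y) (l : left A ⟶ left B) (h : l ≫ proj B = proj A ≫ f)
    (hs : (R.map (square f l h)).left ≫ strLeft B = strLeft A ≫ l)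
    (hs' : (R.map (square f l h)).right ≫ B.1.obj.str.right =
      A.1.obj.str.right ≫ (baseIso A).hom ≫ f ≫ (baseIso B).inv) : A.1 ⟶ B.1 :=
  ObjectProperty.homMk ⟨square f l h, Arrow.hom_ext _ _ hs hs'⟩

theorem map_homLeft_strLeft {X Y : C} {A : (pointedAlgebraCod η).Fiber X}
    {B : (pointedAlgebraCod η).Fiber Y} (φ : A.1 ⟶ B.1) :
    (R.map φ.hom.f).left ≫ strLeft B = strLeft A ≫ homLeft φ :=
  congrArg CommaMorphism.left φ.hom.h

/-- If an arrow into `P` becomes an algebra morphism after composition with `φ`, its compatibility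
with structure maps holds up to `homLeft φ`. With `map_square_strLeft_proj`, this yields actual
compatibility when `P` is a pullback. -/
theorem map_square_strLeft_homLeft {V X Y : C} {Z : (pointedAlgebraCod η).Fiber V}
    {P : (pointedAlgebraCod η).Fiber X} {A : (pointedAlgebraCod η).Fiber Y} (f : V ⟶ X) (g : X ⟶ Y)
    (φ : P.1 ⟶ A.1) [(pointedAlgebraCod η).IsHomLift g φ] (ψ : Z.1 ⟶ A.1)
    [(pointedAlgebraCod η).IsHomLift (f ≫ g) ψ] (m : left Z ⟶ left P)
    (hm : m ≫ proj P = proj Z ≫ f) (hm' : m ≫ homLeft φ = homLeft ψ) :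
    ((R.map (square f m hm)).left ≫ strLeft P) ≫ homLeft φ = (strLeft Z ≫ m) ≫ homLeft φ := by
  have hsq : square f m hm ≫ φ.hom.f = ψ.hom.f := by
    rw [hom_eq_square g φ, hom_eq_square (f ≫ g) ψ]
    apply Arrow.hom_ext
    · exact hm'
    · simp [square]
  have hR : (R.map (square f m hm)).left ≫ (R.map φ.hom.f).left = (R.map ψ.hom.f).left := by
    rw [← hsq, R.map_comp]
    rfl
  rw [Category.assoc, Category.assoc, hm', ← map_homLeft_strLeft, ← map_homLeft_strLeft,
    reassoc_of% hR]

section OverSquare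

variable {X Y E : C} {q : E ⟶ X} {A : (pointedAlgebraCod η).Fiber Y} {g : X ⟶ Y} {l : E ⟶ left A}

/-- A commutative square from an arrow to the underlying arrow of an algebra. -/
def overSquare (h : l ≫ proj A = q ≫ g) : Arrow.mk q ⟶ carrier A :=
  Arrow.homMk l (g ≫ (baseIso A).inv) (by
    have h' := h =≫ (baseIso A).inv
    simp only [proj, Category.assoc, Iso.hom_inv_id] at h'
    exact (congrArg (l ≫ ·) (Category.comp_id _)).symm.trans h')

theorem unit_overSquare_strLeft (h : l ≫ proj A = q ≫ g) :
    (η.app (Arrow.mk q)).left ≫ (R.map (overSquare h)).left ≫ strLeft A = l := by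
  have hc : (η.app (Arrow.mk q)).left ≫ (R.map (overSquare h)).left =
      l ≫ (η.app (carrier A)).left :=
    congrArg CommaMorphism.left (η.naturality (overSquare h)).symm
  rw [reassoc_of% hc, unit_strLeft]
  exact Category.comp_id _

end OverSquare

variable [∀ F, IsIso (η.app F).right]

/-- The unit law on codomains makes the structure map a retraction of an invertible arrow. -/
theorem str_right {X : C} (A : (pointedAlgebraCod η).Fiber X) :
    A.1.obj.str.right = inv (η.app (carrier A)).right :=
  IsIso.eq_inv_of_hom_inv_id (congrArg CommaMorphism.right A.1.property)

theorem map_right {F G : Arrow C} (φ : F ⟶ G) :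
    (R.map φ).right ≫ inv (η.app G).right = inv (η.app F).right ≫ φ.right := by
  rw [IsIso.comp_inv_eq, Category.assoc, IsIso.eq_inv_comp]
  exact congrArg CommaMorphism.right (η.naturality φ).symm

theorem strLeft_proj {X : C} (A : (pointedAlgebraCod η).Fiber X) :
    strLeft A ≫ proj A =
      (R.obj (carrier A)).hom ≫ inv (η.app (carrier A)).right ≫ (baseIso A).hom := by
  have h : strLeft A ≫ (carrier A).hom = (R.obj (carrier A)).hom ≫ A.1.obj.str.right :=
    A.1.obj.str.w
  rw [str_right] at h
  rw [proj, reassoc_of% h]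

theorem map_strLeft_proj {X : C} (A : (pointedAlgebraCod η).Fiber X) {F : Arrow C}
    (φ : F ⟶ carrier A) : ((R.map φ).left ≫ strLeft A) ≫ proj A =
      ((R.obj F).hom ≫ inv (η.app F).right) ≫ φ.right ≫ (baseIso A).hom := by
  have h : (R.map φ).left ≫ (R.obj (carrier A)).hom = (R.obj F).hom ≫ (R.map φ).right :=
    (R.map φ).w
  rw [Category.assoc, strLeft_proj, reassoc_of% h, reassoc_of% map_right, Category.assoc]

theorem map_square_strLeft_proj {X Y : C} {A : (pointedAlgebraCod η).Fiber X}
    {B : (pointedAlgebraCod η).Fiber Y} (f : X ⟶ Y) (l : left A ⟶ left B)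
    (h : l ≫ proj B = proj A ≫ f) :
    ((R.map (square f l h)).left ≫ strLeft B) ≫ proj B = (strLeft A ≫ l) ≫ proj B := by
  rw [map_strLeft_proj, Category.assoc (strLeft A), h, reassoc_of% strLeft_proj]
  simp [square]

/-- The codomain half of compatibility is automatic, by naturality of `η` and `str_right`. -/
theorem exists_hom {X Y : C} {A : (pointedAlgebraCod η).Fiber X} {B : (pointedAlgebraCod η).Fiber Y}
    (f : X ⟶ Y) (l : left A ⟶ left B) (h : l ≫ proj B = proj A ≫ f)
    (hs : (R.map (square f l h)).left ≫ strLeft B = strLeft A ≫ l) :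
    ∃ φ : A.1 ⟶ B.1, (pointedAlgebraCod η).IsHomLift f φ ∧ homLeft φ = l := by
  refine ⟨mkHom f l h hs ?_, IsHomLift.of_fac' _ _ _ A.2 B.2 rfl, rfl⟩
  rw [str_right, str_right, map_right]
  rfl

/-- The algebra over `X` with underlying arrow `q` and with a given structure map. -/
noncomputable def ofStr {X E : C} (q : E ⟶ X) (s : (R.obj (Arrow.mk q)).left ⟶ E)
    (hs : s ≫ q = (R.obj (Arrow.mk q)).hom ≫ inv (η.app (Arrow.mk q)).right)
    (hu : (η.app (Arrow.mk q)).left ≫ s = 𝟙 E) : (pointedAlgebraCod η).Fiber X :=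
  ⟨⟨⟨Arrow.mk q, Arrow.homMk s (inv (η.app (Arrow.mk q)).right) hs⟩,
    Arrow.hom_ext _ _ hu (IsIso.hom_inv_id (η.app (Arrow.mk q)).right)⟩, rfl⟩

section

variable {X E : C} (q : E ⟶ X) (s : (R.obj (Arrow.mk q)).left ⟶ E)
    (hs : s ≫ q = (R.obj (Arrow.mk q)).hom ≫ inv (η.app (Arrow.mk q)).right)
    (hu : (η.app (Arrow.mk q)).left ≫ s = 𝟙 E)

@[simp]
theorem proj_ofStr : proj (ofStr q s hs hu) = q :=
  Category.comp_id q

end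

/-- The identity of `X` is an algebra. Its projection is monic, so every required equation may be
checked after projecting, where it holds automatically. -/
theorem exists_isFibredTerminal (X : C) :
    ∃ T : (pointedAlgebraCod η).Fiber X, IsFibredTerminal (pointedAlgebraCod η) T := by
  have hu : (η.app (Arrow.mk (𝟙 X))).left ≫
      (R.obj (Arrow.mk (𝟙 X))).hom ≫ inv (η.app (Arrow.mk (𝟙 X))).right = 𝟙 X := by
    have h : (η.app (Arrow.mk (𝟙 X))).left ≫ (R.obj (Arrow.mk (𝟙 X))).hom =
      𝟙 X ≫ (η.app (Arrow.mk (𝟙 X))).right := (η.app (Arrow.mk (𝟙 X))).w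
    rw [reassoc_of% h, IsIso.hom_inv_id]
    rfl
  let T := ofStr (η := η) (𝟙 X) _ (Category.comp_id _) hu
  have hT : proj T = 𝟙 X := proj_ofStr _ _ _ _
  have : Mono (proj T) := by
    rw [hT]
    exact inferInstanceAs (Mono (𝟙 X))
  refine ⟨T, fun Y f Z => ?_⟩
  have hl : (proj Z ≫ f : left Z ⟶ left T) ≫ proj T = proj Z ≫ f := by
    rw [hT]
    exact Category.comp_id _
  obtain ⟨φ, hφ, -⟩ := exists_hom (A := Z) (B := T) f (proj Z ≫ f) hl (by
    rw [← cancel_mono (proj T)]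
    exact map_square_strLeft_proj (A := Z) (B := T) f (proj Z ≫ f) hl)
  refine ⟨φ, hφ, fun ψ hψ => hom_ext_of_homLeft (A := Z) (B := T) f ?_⟩
  dsimp only at hψ
  rw [← cancel_mono (proj T), homLeft_proj f, homLeft_proj f]

section OverSquare

variable {X Y E : C} {q : E ⟶ X} {A : (pointedAlgebraCod η).Fiber Y} {g : X ⟶ Y} {l : E ⟶ left A}

theorem overSquare_strLeft_proj (h : l ≫ proj A = q ≫ g) :
    ((R.map (overSquare h)).left ≫ strLeft A) ≫ proj A =
      ((R.obj (Arrow.mk q)).hom ≫ inv (η.app (Arrow.mk q)).right) ≫ g := by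
  rw [map_strLeft_proj]
  simp [overSquare]

theorem unit_hom_inv (q : E ⟶ X) : (η.app (Arrow.mk q)).left ≫
    (R.obj (Arrow.mk q)).hom ≫ inv (η.app (Arrow.mk q)).right = q := by
  have hw : (η.app (Arrow.mk q)).left ≫ (R.obj (Arrow.mk q)).hom =
    q ≫ (η.app (Arrow.mk q)).right := (η.app (Arrow.mk q)).w
  rw [reassoc_of% hw, IsIso.hom_inv_id]
  exact Category.comp_id _

theorem exists_hom_ofStr (h : l ≫ proj A = q ≫ g) {s : (R.obj (Arrow.mk q)).left ⟶ E}
    (hs : s ≫ q = (R.obj (Arrow.mk q)).hom ≫ inv (η.app (Arrow.mk q)).right)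
    (hu : (η.app (Arrow.mk q)).left ≫ s = 𝟙 E)
    (hl : s ≫ l = (R.map (overSquare h)).left ≫ strLeft A) :
    ∃ φ : (ofStr q s hs hu).1 ⟶ A.1, (pointedAlgebraCod η).IsHomLift g φ ∧ homLeft φ = l := by
  have h' : l ≫ proj A = proj (ofStr q s hs hu) ≫ g :=
    h.trans (congrArg (· ≫ g) (proj_ofStr q s hs hu).symm)
  refine exists_hom (A := ofStr q s hs hu) g l h' ?_
  have hsq : square (A := ofStr q s hs hu) g l h' = overSquare h := by
    apply Arrow.hom_ext
    · rfl
    · exact Category.id_comp _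
  rw [hsq]
  exact hl.symm

end OverSquare

/-! ### Cartesian lifts and fibre products from pullbacks -/

section Pullback

variable [HasPullbacks C]

/-- The reindexing of an algebra, with a pullback as its underlying arrow. -/
theorem exists_isStronglyCartesian_isPullback {X Y : C} (A : (pointedAlgebraCod η).Fiber Y)
    (g : X ⟶ Y) : ∃ (P : (pointedAlgebraCod η).Fiber X) (φ : P.1 ⟶ A.1),
      (pointedAlgebraCod η).IsStronglyCartesian g φ ∧
        IsPullback (homLeft φ) (proj P) (proj A) g := by
  let q := pullback.snd (proj A) g
  have hsq : pullback.fst (proj A) g ≫ proj A = q ≫ g := pullback.condition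
  -- The first component is forced if the projection to `A` is to be an algebra morphism; the second
  -- is forced by `q`.
  let s : (R.obj (Arrow.mk q)).left ⟶ pullback (proj A) g :=
    pullback.lift ((R.map (overSquare hsq)).left ≫ strLeft A)
      ((R.obj (Arrow.mk q)).hom ≫ inv (η.app (Arrow.mk q)).right) (overSquare_strLeft_proj hsq)
  have hu : (η.app (Arrow.mk q)).left ≫ s = 𝟙 (pullback (proj A) g) := by
    apply pullback.hom_ext
    · rw [Category.assoc, pullback.lift_fst, unit_overSquare_strLeft]
      exact (Category.id_comp _).symm
    · rw [Category.assoc, pullback.lift_snd, unit_hom_inv]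
      exact (Category.id_comp _).symm
  let P := ofStr q s (pullback.lift_snd _ _ _) hu
  obtain ⟨φ, hφ, hl⟩ : ∃ φ : P.1 ⟶ A.1, (pointedAlgebraCod η).IsHomLift g φ ∧
    homLeft φ = pullback.fst (proj A) g := exists_hom_ofStr hsq _ hu (pullback.lift_fst _ _ _)
  have hP : IsPullback (homLeft φ) (proj P) (proj A) g := by
    rw [hl, show proj P = q from proj_ofStr _ _ _ _]
    exact IsPullback.of_hasPullback (proj A) g
  refine ⟨P, φ, ⟨fun {Z'} f ψ hψ => ?_⟩, hP⟩
  let Z : (pointedAlgebraCod η).Fiber ((pointedAlgebraCod η).obj Z') := ⟨Z', rfl⟩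
  change Z.1 ⟶ A.1 at ψ
  let m := hP.lift (homLeft ψ) (proj Z ≫ f) (by rw [homLeft_proj (f ≫ g) ψ, Category.assoc])
  have hm : m ≫ proj P = proj Z ≫ f := hP.lift_snd _ _ _
  have hm' : m ≫ homLeft φ = homLeft ψ := hP.lift_fst _ _ _
  obtain ⟨χ, hχ, hχl⟩ := exists_hom f m hm
    (hP.hom_ext (map_square_strLeft_homLeft f g φ ψ m hm hm') (map_square_strLeft_proj f m hm))
  refine ⟨χ, ⟨hχ, ?_⟩, fun χ' ⟨hχ', hχ''⟩ => ?_⟩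
  · refine hom_ext_of_homLeft (A := Z) (B := A) (f ≫ g) ?_
    rw [homLeft_comp (A := Z) (B := P) (D := A), hχl, hm']
  · refine hom_ext_of_homLeft (A := Z) (B := P) f ?_
    rw [hχl]
    apply hP.hom_ext
    · rw [hm', ← hχ'', homLeft_comp (A := Z) (B := P) (D := A)]
    · rw [hm, homLeft_proj (A := Z) (B := P) f]

/-- The product of two algebras in a fibre, with a pullback as the domain of its underlying
arrow. -/
theorem exists_isFibredProduct_isPullback {X : C} (A₁ A₂ : (pointedAlgebraCod η).Fiber X) :
    ∃ (W : (pointedAlgebraCod η).Fiber X) (π₁ : W ⟶ A₁) (π₂ : W ⟶ A₂),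
      IsFibredProduct (pointedAlgebraCod η) π₁ π₂ ∧
        IsPullback (homLeft π₁.1) (homLeft π₂.1) (proj A₁) (proj A₂) := by
  let q := pullback.fst (proj A₁) (proj A₂) ≫ proj A₁
  have hsq₁ : pullback.fst (proj A₁) (proj A₂) ≫ proj A₁ = q ≫ 𝟙 X := (Category.comp_id _).symm
  have hsq₂ : pullback.snd (proj A₁) (proj A₂) ≫ proj A₂ = q ≫ 𝟙 X :=
    pullback.condition.symm.trans hsq₁
  -- Both components are forced if the two projections are to be algebra morphisms.
  let s : (R.obj (Arrow.mk q)).left ⟶ pullback (proj A₁) (proj A₂) :=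
    pullback.lift ((R.map (overSquare hsq₁)).left ≫ strLeft A₁)
      ((R.map (overSquare hsq₂)).left ≫ strLeft A₂)
      ((overSquare_strLeft_proj hsq₁).trans (overSquare_strLeft_proj hsq₂).symm)
  have hs : s ≫ q = (R.obj (Arrow.mk q)).hom ≫ inv (η.app (Arrow.mk q)).right := by
    rw [pullback.lift_fst_assoc, overSquare_strLeft_proj hsq₁]
    exact Category.comp_id _
  have hu : (η.app (Arrow.mk q)).left ≫ s = 𝟙 (pullback (proj A₁) (proj A₂)) := by
    apply pullback.hom_ext
    · rw [Category.assoc, pullback.lift_fst, unit_overSquare_strLeft]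
      exact (Category.id_comp _).symm
    · rw [Category.assoc, pullback.lift_snd, unit_overSquare_strLeft]
      exact (Category.id_comp _).symm
  let W := ofStr q s hs hu
  obtain ⟨π₁, hπ₁, hl₁⟩ : ∃ φ : W.1 ⟶ A₁.1, (pointedAlgebraCod η).IsHomLift (𝟙 X) φ ∧
      homLeft φ = pullback.fst (proj A₁) (proj A₂) :=
    exists_hom_ofStr hsq₁ hs hu (pullback.lift_fst _ _ _)
  obtain ⟨π₂, hπ₂, hl₂⟩ : ∃ φ : W.1 ⟶ A₂.1, (pointedAlgebraCod η).IsHomLift (𝟙 X) φ ∧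
      homLeft φ = pullback.snd (proj A₁) (proj A₂) :=
    exists_hom_ofStr hsq₂ hs hu (pullback.lift_snd _ _ _)
  have hW : IsPullback (homLeft π₁) (homLeft π₂) (proj A₁) (proj A₂) := by
    rw [hl₁, hl₂]
    exact IsPullback.of_hasPullback (proj A₁) (proj A₂)
  have hproj : homLeft π₁ ≫ proj A₁ = proj W := by
    rw [homLeft_proj (𝟙 X) π₁, Category.comp_id]
  refine ⟨W, ⟨π₁, hπ₁⟩, ⟨π₂, hπ₂⟩, ⟨fun Y f Z α₁ α₂ h₁ h₂ => ?_⟩, hW⟩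
  let m := hW.lift (homLeft α₁) (homLeft α₂)
    ((homLeft_proj f α₁).trans (homLeft_proj f α₂).symm)
  have hm₁ : m ≫ homLeft π₁ = homLeft α₁ := hW.lift_fst _ _ _
  have hm₂ : m ≫ homLeft π₂ = homLeft α₂ := hW.lift_snd _ _ _
  have hm : m ≫ proj W = proj Z ≫ f := by
    rw [← hproj, reassoc_of% hm₁, homLeft_proj f]
  obtain ⟨χ, hχ, hχl⟩ := exists_hom f m hm
    (hW.hom_ext (map_square_strLeft_homLeft f (𝟙 X) π₁ α₁ m hm hm₁)
      (map_square_strLeft_homLeft f (𝟙 X) π₂ α₂ m hm hm₂))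
  refine ⟨χ, ⟨hχ, ?_, ?_⟩, fun χ' ⟨hχ', hχ₁, hχ₂⟩ => ?_⟩
  · refine hom_ext_of_homLeft (A := Z) (B := A₁) f ?_
    rw [homLeft_comp (A := Z) (B := W) (D := A₁), hχl, hm₁]
  · refine hom_ext_of_homLeft (A := Z) (B := A₂) f ?_
    rw [homLeft_comp (A := Z) (B := W) (D := A₂), hχl, hm₂]
  · refine hom_ext_of_homLeft (A := Z) (B := W) f ?_
    rw [hχl]
    apply hW.hom_ext
    · rw [hm₁, ← hχ₁, homLeft_comp (A := Z) (B := W) (D := A₁)]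
    · rw [hm₂, ← hχ₂, homLeft_comp (A := Z) (B := W) (D := A₂)]

instance isFibered : (pointedAlgebraCod η).IsFibered :=
  Functor.IsFibered.of_exists_isStronglyCartesian fun a X f => by
    obtain ⟨P, φ, hφ, -⟩ := exists_isStronglyCartesian_isPullback (η := η) ⟨a, rfl⟩ f
    exact ⟨P.1, φ, hφ⟩

/-- The algebras for a pointed endofunctor over the codomain functor form a fibration with
products. -/
instance isFibrationWithProducts [HasTerminal C] :
    IsFibrationWithProducts (pointedAlgebraCod η) :=
  have : HasFiniteLimits C := hasFiniteLimits_of_hasTerminal_and_pullbacks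
  isFibrationWithProducts_of_fibred exists_isFibredTerminal fun _ A₁ A₂ =>
    let ⟨W, π₁, π₂, h, _⟩ := exists_isFibredProduct_isPullback A₁ A₂
    ⟨W, π₁, π₂, h⟩

/-- The chosen cartesian lift differs from the one built on a pullback by a vertical isomorphism. -/
theorem isPullback_cartLift {X Y : C} (A : (pointedAlgebraCod η).Fiber Y) (g : X ⟶ Y) :
    IsPullback (homLeft (cartLift g A)) (proj ((reindex (pointedAlgebraCod η) g).obj A))
      (proj A) g := by
  obtain ⟨P, φ, hφ, hP⟩ := exists_isStronglyCartesian_isPullback A g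
  let Q := (reindex (pointedAlgebraCod η) g).obj A
  let e : Q.1 ≅ P.1 :=
    Functor.IsCartesian.domainUniqueUpToIso (pointedAlgebraCod η) g φ (cartLift g A)
  have he : (pointedAlgebraCod η).IsHomLift (𝟙 X) e.hom :=
    Functor.IsCartesian.domainUniqueUpToIso_inv_isHomLift (pointedAlgebraCod η) g φ (cartLift g A)
  have hfac : e.hom ≫ φ = cartLift g A :=
    Functor.IsCartesian.fac (pointedAlgebraCod η) g φ (cartLift g A)
  let e' : left Q ≅ left P := ⟨homLeft (A := Q) (B := P) e.hom, homLeft (A := P) (B := Q) e.inv, by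
    rw [← homLeft_comp (A := Q) (B := P) (D := Q), e.hom_inv_id]; rfl, by
    rw [← homLeft_comp (A := P) (B := Q) (D := P), e.inv_hom_id]; rfl⟩
  refine hP.of_iso e'.symm (Iso.refl _) (Iso.refl _) (Iso.refl _) ?_ ?_ (by simp) (by simp)
  · rw [Iso.refl_hom, Category.comp_id, Iso.symm_hom, Iso.eq_inv_comp, ← hfac]
    rfl
  · rw [Iso.refl_hom, Category.comp_id, Iso.symm_hom, Iso.eq_inv_comp]
    exact (homLeft_proj (A := Q) (B := P) (𝟙 X) e.hom).trans (Category.comp_id _)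

theorem isPullback_prod [HasTerminal C] {X : C} (A₁ A₂ : (pointedAlgebraCod η).Fiber X) :
    IsPullback (homLeft (fstVal A₁ A₂)) (homLeft (sndVal A₁ A₂)) (proj A₁) (proj A₂) := by
  obtain ⟨W, π₁, π₂, h, hW⟩ := exists_isFibredProduct_isPullback A₁ A₂
  let e : A₁ ⨯ A₂ ≅ W := (prodIsProd A₁ A₂).conePointUniqueUpToIso h.nonempty_isLimit.some
  have h₁ : e.hom ≫ π₁ = prod.fst :=
    (prodIsProd A₁ A₂).conePointUniqueUpToIso_hom_comp h.nonempty_isLimit.some ⟨.left⟩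
  have h₂ : e.hom ≫ π₂ = prod.snd :=
    (prodIsProd A₁ A₂).conePointUniqueUpToIso_hom_comp h.nonempty_isLimit.some ⟨.right⟩
  let e' : left (A₁ ⨯ A₂) ≅ left W := ⟨homLeft e.hom.1, homLeft e.inv.1, by
    rw [← homLeft_comp, ← comp_val, e.hom_inv_id]; rfl, by
    rw [← homLeft_comp, ← comp_val, e.inv_hom_id]; rfl⟩
  refine hW.of_iso e'.symm (Iso.refl _) (Iso.refl _) (Iso.refl _) ?_ ?_ (by simp) (by simp)
  · rw [Iso.refl_hom, Category.comp_id, Iso.symm_hom, Iso.eq_inv_comp, fstVal, ← h₁]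
    rfl
  · rw [Iso.refl_hom, Category.comp_id, Iso.symm_hom, Iso.eq_inv_comp, sndVal, ← h₂]
    rfl

end Pullback

end PointedAlgebraFibre

/-! ### A path that meets the parametrised diagonal -/

namespace FibProd

variable {C : Type*} [Category* C] [HasFiniteProducts C]

theorem parDiag_fst_snd (Y X : C) :
    parDiag Y X ≫ prod.fst ≫ prod.snd = parDiag Y X ≫ prod.snd := by
  simp [parDiag, prod.lift_fst_assoc, prod.lift_snd]

/-- The arrow `i ↦ ((a, z i), b)`, for `a` in `Y` and `b` in `X`. -/
noncomputable def pathInProd {P I X Y : C} (r : I ⟶ P) (a : P ⟶ Y) (b : P ⟶ X) (z : I ⟶ X) :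
    I ⟶ (Y ⨯ X) ⨯ X :=
  prod.lift (prod.lift (r ≫ a) z) (r ≫ b)

section

variable {P I X Y : C} (r : I ⟶ P) (a : P ⟶ Y) (b : P ⟶ X) (z : I ⟶ X)

theorem lift_parDiag_eq {i : P ⟶ I} (hr : i ≫ r = 𝟙 P) (hz : i ≫ z = b) :
    prod.lift a b ≫ parDiag Y X = i ≫ pathInProd r a b z := by
  have h := reassoc_of% hr
  ext <;> simp [parDiag, pathInProd, h, hz, prod.lift_fst, prod.lift_snd]

theorem pathInProd_fst_snd : pathInProd r a b z ≫ prod.fst ≫ prod.snd = z := by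
  simp [pathInProd, prod.lift_fst_assoc, prod.lift_snd]

theorem pathInProd_snd : pathInProd r a b z ≫ prod.snd = r ≫ b :=
  prod.lift_snd _ _

theorem lift_parDiag_fst_snd : prod.lift a b ≫ parDiag Y X ≫ prod.fst ≫ prod.snd = b := by
  simp [parDiag, prod.lift_fst_assoc, prod.lift_snd]

end

end FibProd

/-! ### Path lifting and the failure of elementarity -/

namespace PointedAlgebraFibre

open FibProd

universe v w

variable {C : Type w} [Category.{v} C] {R : Arrow C ⥤ Arrow C}

/-- Data that let an algebra for `R` lift a path `x : I ⟶ X` to its codomain, with a given lift of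
the endpoint `i₁`, to a point over the endpoint `i₀`, in such a way that a constant path is lifted
to the given point. -/
structure PathLifting (η : 𝟭 (Arrow C) ⟶ R) where
  /-- the object that parametrizes points -/
  pt : C
  /-- the object that parametrizes paths -/
  I : C
  /-- the endpoint over which the lift is constructed -/
  i₀ : pt ⟶ I
  /-- the endpoint over which the lift is given -/
  i₁ : pt ⟶ I
  /-- the constant path -/
  r : I ⟶ pt
  i₁_r : i₁ ≫ r = 𝟙 pt
  /-- the point of the domain of `R F` given by a path and a lift of its endpoint `i₁` -/
  pathMk (F : Arrow C) (e : pt ⟶ F.left) (x : I ⟶ F.right) (h : e ≫ F.hom = i₁ ≫ x) :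
    pt ⟶ (R.obj F).left
  pathMk_hom (F : Arrow C) (e : pt ⟶ F.left) (x : I ⟶ F.right) (h : e ≫ F.hom = i₁ ≫ x) :
    pathMk F e x h ≫ (R.obj F).hom = i₀ ≫ x ≫ (η.app F).right
  pathMk_map {F G : Arrow C} (φ : F ⟶ G) (e : pt ⟶ F.left) (x : I ⟶ F.right)
    (h : e ≫ F.hom = i₁ ≫ x) (h' : (e ≫ φ.left) ≫ G.hom = i₁ ≫ x ≫ φ.right) :
    pathMk F e x h ≫ (R.map φ).left = pathMk G (e ≫ φ.left) (x ≫ φ.right) h'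
  pathMk_const (F : Arrow C) (e : pt ⟶ F.left) (h : e ≫ F.hom = i₁ ≫ r ≫ e ≫ F.hom) :
    pathMk F e (r ≫ e ≫ F.hom) h = e ≫ (η.app F).left

namespace PathLifting

variable {η : 𝟭 (Arrow C) ⟶ R} (S : PathLifting η)

section

variable {X Y : C} {A : (pointedAlgebraCod η).Fiber X} {B : (pointedAlgebraCod η).Fiber Y}

theorem hom_eq_of_proj_eq {e : S.pt ⟶ left A} {x : S.I ⟶ X} (h : e ≫ proj A = S.i₁ ≫ x) :
    e ≫ (carrier A).hom = S.i₁ ≫ x ≫ (baseIso A).inv := by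
  have h' := h =≫ (baseIso A).inv
  simpa [proj] using h'

/-- The point of an algebra obtained by lifting a path. -/
def move (e : S.pt ⟶ left A) (x : S.I ⟶ X) (h : e ≫ proj A = S.i₁ ≫ x) : S.pt ⟶ left A :=
  S.pathMk (carrier A) e (x ≫ (baseIso A).inv) (S.hom_eq_of_proj_eq h) ≫ strLeft A

theorem move_congr {e e' : S.pt ⟶ left A} {x x' : S.I ⟶ X} (he : e = e') (hx : x = x')
    (h : e ≫ proj A = S.i₁ ≫ x) : S.move e x h = S.move e' x' (by rw [← he, ← hx, h]) := by
  subst he hx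
  rfl

theorem move_proj [∀ F, IsIso (η.app F).right] (e : S.pt ⟶ left A) (x : S.I ⟶ X)
    (h : e ≫ proj A = S.i₁ ≫ x) : S.move e x h ≫ proj A = S.i₀ ≫ x := by
  have h₁ := S.pathMk_hom (carrier A) e (x ≫ (baseIso A).inv) (S.hom_eq_of_proj_eq h)
  rw [move, Category.assoc, strLeft_proj, reassoc_of% h₁, IsIso.hom_inv_id_assoc]
  change S.i₀ ≫ x ≫ (baseIso A).inv ≫ (baseIso A).hom = _
  simp

theorem comp_homLeft_proj {e : S.pt ⟶ left A} {x : S.I ⟶ X} (h : e ≫ proj A = S.i₁ ≫ x)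
    (f : X ⟶ Y) (φ : A.1 ⟶ B.1) [(pointedAlgebraCod η).IsHomLift f φ] :
    (e ≫ homLeft φ) ≫ proj B = S.i₁ ≫ x ≫ f := by
  rw [Category.assoc, homLeft_proj f φ, reassoc_of% h]

/-- Algebra morphisms preserve lifts, also over a non-identity `f`: `pathMk` is natural, and `φ`
commutes with the structure maps. -/
theorem move_homLeft (e : S.pt ⟶ left A) (x : S.I ⟶ X) (h : e ≫ proj A = S.i₁ ≫ x)
    (f : X ⟶ Y) (φ : A.1 ⟶ B.1) [(pointedAlgebraCod η).IsHomLift f φ]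
    (h' : (e ≫ homLeft φ) ≫ proj B = S.i₁ ≫ x ≫ f) :
    S.move e x h ≫ homLeft φ = S.move (e ≫ homLeft φ) (x ≫ f) h' := by
  have hr : (x ≫ (baseIso A).inv) ≫ φ.hom.f.right = (x ≫ f) ≫ (baseIso B).inv := by
    rw [hom_eq_square f φ]
    simp [square]
  have h₂ : (e ≫ φ.hom.f.left) ≫ (carrier B).hom =
      S.i₁ ≫ (x ≫ (baseIso A).inv) ≫ φ.hom.f.right := by
    rw [hr]
    exact S.hom_eq_of_proj_eq h'
  have h₁ := S.pathMk_map φ.hom.f e (x ≫ (baseIso A).inv) (S.hom_eq_of_proj_eq h) h₂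
  rw [move, Category.assoc, ← map_homLeft_strLeft, reassoc_of% h₁, move]
  congr 2
  simpa using hr

/-- This is normality: for a constant path `pathMk` gives the image of `e` under the unit, which the
structure map sends back to `e`. -/
theorem move_const (e : S.pt ⟶ left A) (x : S.I ⟶ X) (h : e ≫ proj A = S.i₁ ≫ x)
    (hx : x = S.r ≫ e ≫ proj A) : S.move e x h = e := by
  have hx' : x ≫ (baseIso A).inv = S.r ≫ e ≫ (carrier A).hom := by
    rw [hx]
    simp [proj]
  have h₁ : S.pathMk (carrier A) e (x ≫ (baseIso A).inv) (S.hom_eq_of_proj_eq h) =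
      e ≫ (η.app (carrier A)).left := by
    rw [← S.pathMk_const (carrier A) e (by rw [← hx', S.hom_eq_of_proj_eq h])]
    congr 1
  rw [move, h₁, Category.assoc, unit_strLeft, Category.comp_id]

end

/-- If lifting the identity path of `I` is not injective for some algebra over `I`, then the
fibration of algebras is not elementary. -/
theorem not_isElementary [HasPullbacks C] [HasTerminal C] [∀ F, IsIso (η.app F).right]
    (A : (pointedAlgebraCod η).Fiber S.I) (a b : S.pt ⟶ left A) (hab : a ≠ b)
    (ha : a ≫ proj A = S.i₁ ≫ 𝟙 S.I) (hb : b ≫ proj A = S.i₁ ≫ 𝟙 S.I)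
    (h : S.move a (𝟙 S.I) ha = S.move b (𝟙 S.I) hb) : ¬ IsElementary (pointedAlgebraCod η) := by
  intro hE
  have := hE.base
  let δ : S.I ⨯ S.I ⟶ (S.I ⨯ S.I) ⨯ S.I := parDiag S.I S.I
  let π₁ : (S.I ⨯ S.I) ⨯ S.I ⟶ S.I := prod.fst ≫ prod.snd
  let π₂ : (S.I ⨯ S.I) ⨯ S.I ⟶ S.I := prod.snd
  have hδ : δ ≫ π₁ = δ ≫ π₂ := parDiag_fst_snd S.I S.I
  let A₁ := (reindex (pointedAlgebraCod η) π₁).obj A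
  -- All that matters about `K` is that it has a point over `q`, which serves as common second
  -- component.
  let K := (reindex (pointedAlgebraCod η) δ).obj A₁
  obtain ⟨L, adj, hfrob⟩ : ∃ (L : (pointedAlgebraCod η).Fiber (S.I ⨯ S.I) ⥤
      (pointedAlgebraCod η).Fiber ((S.I ⨯ S.I) ⨯ S.I))
      (adj : L ⊣ reindex (pointedAlgebraCod η) δ),
      IsIso (frobeniusHom (pointedAlgebraCod η) adj K A₁) := by
    obtain ⟨L, adj, hfrob, -⟩ := hE.exists_leftAdjoint
    exact ⟨L S.I S.I, adj S.I S.I, hfrob S.I S.I K A₁⟩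
  obtain ⟨e, s, T, he, hs, hT, he₁, he₂, heT⟩ := exists_transport hδ adj A K
  let q : S.pt ⟶ S.I ⨯ S.I := prod.lift S.i₁ S.i₁
  -- The path `t ↦ ((i₁, t), i₁)`, which at `i₁` is the diagonal point `q ≫ δ`.
  let y : S.I ⟶ (S.I ⨯ S.I) ⨯ S.I := pathInProd S.r S.i₁ S.i₁ (𝟙 S.I)
  have hqy : q ≫ δ = S.i₁ ≫ y := lift_parDiag_eq _ _ _ _ S.i₁_r (Category.comp_id _)
  have hy₁ : y ≫ π₁ = 𝟙 S.I := pathInProd_fst_snd _ _ _ _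
  have hy₂ : y ≫ π₂ = S.r ≫ S.i₁ := pathInProd_snd _ _ _ _
  have hqδ : q ≫ δ ≫ π₁ = S.i₁ := lift_parDiag_fst_snd _ _
  have hA₁ := isPullback_cartLift A π₁
  have hK := isPullback_cartLift A₁ δ
  have hU := isPullback_prod K K
  have hW := isPullback_prod A₁ (L.obj K)
  -- a point of `A` over `i₁` yields one of `K` over `q`
  have point (c : S.pt ⟶ left A) (hc : c ≫ proj A = S.i₁ ≫ 𝟙 S.I) : ∃ c' : S.pt ⟶ left K,
      c' ≫ homLeft (cartLift δ A₁) ≫ homLeft (cartLift π₁ A) = c ∧ c' ≫ proj K = q := by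
    obtain ⟨c₁, h₁, h₂⟩ := hA₁.exists_lift c (q ≫ δ) (by rw [hc, Category.assoc, hqδ]; simp)
    obtain ⟨c₂, h₃, h₄⟩ := hK.exists_lift c₁ q h₂
    exact ⟨c₂, by rw [reassoc_of% h₃, h₁], h₄⟩
  obtain ⟨a', ha₁, ha₂⟩ := point a ha
  obtain ⟨b', hb₁, hb₂⟩ := point b hb
  have hs' : (a' ≫ homLeft s) ≫ proj (L.obj K) = S.i₁ ≫ y := by
    rw [Category.assoc, homLeft_proj δ s, reassoc_of% ha₂, hqy]
  -- its image in the product of `A₁` and `L K`, lifted along `y`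
  have main (c : S.pt ⟶ left A) (hc : c ≫ proj A = S.i₁ ≫ 𝟙 S.I) (c' : S.pt ⟶ left K)
      (hc₁ : c' ≫ homLeft (cartLift δ A₁) ≫ homLeft (cartLift π₁ A) = c)
      (hc₂ : c' ≫ proj K = q) : ∃ m : S.pt ⟶ left (A₁ ⨯ L.obj K),
        m ≫ homLeft T = c ∧
        (m ≫ homLeft (fstVal _ _)) ≫ homLeft (cartLift π₁ A) = S.move c (𝟙 S.I) hc ∧
        (m ≫ homLeft (fstVal _ _)) ≫ proj A₁ = S.i₀ ≫ y ∧
        m ≫ homLeft (sndVal _ _) = S.move (a' ≫ homLeft s) y hs' := by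
    -- The point `(c', a')` of `K ⨯ K`: only the first component depends on `c`.
    obtain ⟨u, hu₁, hu₂⟩ := hU.exists_lift c' a' (hc₂.trans ha₂.symm)
    have hproj (D D' : (pointedAlgebraCod η).Fiber ((S.I ⨯ S.I) ⨯ S.I)) :
        homLeft (fstVal D D') ≫ proj D = proj (D ⨯ D') :=
      (homLeft_proj (𝟙 _) (fstVal D D')).trans (Category.comp_id _)
    have hu : u ≫ proj (K ⨯ K) = q := by
      have h := homLeft_proj (𝟙 _) (fstVal K K)
      rw [Category.comp_id] at h
      rw [← h, reassoc_of% hu₁, hc₂]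
    have hw : (u ≫ homLeft e) ≫ proj (A₁ ⨯ L.obj K) = S.i₁ ≫ y := by
      rw [Category.assoc, homLeft_proj δ e, reassoc_of% hu, hqy]
    have hw₁ : (u ≫ homLeft e) ≫ homLeft (fstVal A₁ (L.obj K)) =
        c' ≫ homLeft (cartLift δ A₁) := by
      rw [Category.assoc, ← homLeft_comp, he₁, homLeft_comp, reassoc_of% hu₁]
    have hw₂ : (u ≫ homLeft e) ≫ homLeft (sndVal A₁ (L.obj K)) = a' ≫ homLeft s := by
      rw [Category.assoc, ← homLeft_comp, he₂, homLeft_comp, reassoc_of% hu₂]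
    have hwT : (u ≫ homLeft e) ≫ homLeft T = c := by
      rw [Category.assoc, ← homLeft_comp, heT, homLeft_comp, homLeft_comp, reassoc_of% hu₁, hc₁]
    refine ⟨S.move (u ≫ homLeft e) y hw, ?_, ?_, ?_, ?_⟩
    · have hT' := (S.comp_homLeft_proj hw π₂ T)
      rw [S.move_homLeft _ _ hw π₂ T hT', S.move_congr hwT rfl]
      refine S.move_const _ _ _ ?_
      rw [hc, hy₂, Category.comp_id]
    · rw [S.move_homLeft _ _ hw (𝟙 _) (fstVal _ _) (S.comp_homLeft_proj hw (𝟙 _) (fstVal _ _)),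
        S.move_homLeft _ _ (S.comp_homLeft_proj hw (𝟙 _) (fstVal _ _)) π₁ (cartLift π₁ A)
          (S.comp_homLeft_proj (S.comp_homLeft_proj hw (𝟙 _) (fstVal _ _)) π₁ (cartLift π₁ A))]
      refine S.move_congr ?_ ?_ _
      · rw [hw₁, Category.assoc, hc₁]
      · rw [Category.comp_id, hy₁]
    · rw [Category.assoc, hproj, S.move_proj]
    · rw [S.move_homLeft _ _ hw (𝟙 _) (sndVal _ _) (S.comp_homLeft_proj hw (𝟙 _) (sndVal _ _))]
      exact S.move_congr hw₂ (Category.comp_id _) _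
  obtain ⟨m, hmT, hm₁, hm₂, hm₃⟩ := main a ha a' ha₁ ha₂
  obtain ⟨n, hnT, hn₁, hn₂, hn₃⟩ := main b hb b' hb₁ hb₂
  refine hab ?_
  rw [← hmT, ← hnT]
  congr 1
  -- The points `m` and `n` agree in `A₁`, a pullback of `A`, by `h` and because both lie over `i₀ ≫
  -- y`; in `L K` both are the lift of the same point.
  refine hW.hom_ext (hA₁.hom_ext ?_ ?_) ?_
  · rw [hm₁, hn₁, h]
  · rw [hm₂, hn₂]
  · rw [hm₃, hn₃]

end PathLifting

end PointedAlgebraFibre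

/-! ### Indiscrete groupoids and the interval -/

/-- The groupoid on `T` with exactly one arrow between any two objects. -/
structure Indiscrete (T : Type u) : Type u where
  as : T

namespace Indiscrete

variable {T : Type u}

instance : Groupoid.{u} (Indiscrete T) where
  Hom _ _ := PUnit
  id _ := ⟨⟩
  comp _ _ := ⟨⟩
  inv _ := ⟨⟩

instance (x y : Indiscrete T) : Subsingleton (x ⟶ y) := inferInstanceAs (Subsingleton PUnit)

/-- A function on objects, as a functor to an indiscrete groupoid. -/
@[simps]
def functor {X : Type u} [Category.{u} X] (f : X → T) : X ⥤ Indiscrete T where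
  obj x := ⟨f x⟩
  map _ := ⟨⟩

theorem functor_ext {X : Type u} [Category.{u} X] {F G : X ⥤ Indiscrete T}
    (h : ∀ x, F.obj x = G.obj x) : F = G :=
  CategoryTheory.Functor.ext h (fun _ _ _ => Subsingleton.elim _ _)

/-- The isomorphism between two objects. -/
def iso (x y : Indiscrete T) : x ≅ y := ⟨⟨⟩, ⟨⟩, rfl, rfl⟩

/-- The functor given by an object. -/
@[simps]
def point {X : Type u} [Category.{u} X] (x : X) : Indiscrete PUnit.{u + 1} ⥤ X where
  obj _ := x
  map _ := 𝟙 x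

theorem eq_point {X : Type u} [Category.{u} X] (F : Indiscrete PUnit.{u + 1} ⥤ X) :
    F = point (F.obj ⟨⟨⟩⟩) :=
  CategoryTheory.Functor.ext (fun _ => rfl) (fun a b f => by
    obtain rfl : f = 𝟙 (⟨⟨⟩⟩ : Indiscrete PUnit) := Subsingleton.elim _ _
    exact (F.map_id ⟨⟨⟩⟩).trans ((Category.id_comp _).trans (Category.id_comp _)).symm)

/-- It reduces the equations demanded of a path lifting to equations between objects. -/
theorem point_ext {X : Type u} [Category.{u} X] {F G : Indiscrete PUnit.{u + 1} ⥤ X}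
    (h : F.obj ⟨⟨⟩⟩ = G.obj ⟨⟨⟩⟩) : F = G := by
  rw [eq_point F, eq_point G, h]

/-- The groupoid with two isomorphic objects. -/
abbrev Interval := Indiscrete (ULift.{u} Bool)

/-- An endpoint of the interval. -/
abbrev endpoint (i : Bool) : Interval.{u} := ⟨⟨i⟩⟩

end Indiscrete

/-! ### Paths in `M F` and normal cleavages of indiscrete groupoids -/

namespace IsoFact

open Indiscrete

section

variable {A : Type u} [Category.{u} A] {B : Type u} [Category.{u} B]

/-- The object of `M F` given by a path and a lift of one endpoint. -/
def ofPath (F : A ⥤ B) (a : A) (x : Interval.{u} ⥤ B) (h : F.obj a = x.obj (endpoint true)) : M F :=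
  ⟨a, x.obj (endpoint false), x.mapIso (iso _ _) ≪≫ eqToIso h.symm⟩

theorem ofPath_const (F : A ⥤ B) (e : Indiscrete PUnit.{u + 1} ⥤ A)
    (h : F.obj (e.obj ⟨⟨⟩⟩) = F.obj (e.obj ⟨⟨⟩⟩)) :
    ofPath F (e.obj ⟨⟨⟩⟩) (functor (fun _ => PUnit.unit) ⋙ e ⋙ F) h = (L F).obj (e.obj ⟨⟨⟩⟩) :=
  M.ext_heq rfl rfl (heq_of_eq (by
    change F.map (e.map (𝟙 _)) ≫ 𝟙 (F.obj (e.obj ⟨⟨⟩⟩)) = 𝟙 (F.obj (e.obj ⟨⟨⟩⟩))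
    simp))

variable {A' : Type u} [Category.{u} A'] {B' : Type u} [Category.{u} B']

theorem mapM_ofPath {F : A ⥤ B} {G : A' ⥤ B'} (H : A ⥤ A') (K : B ⥤ B') (w : H ⋙ G = F ⋙ K)
    (a : A) (x : Interval.{u} ⥤ B) (h : F.obj a = x.obj (endpoint true))
    (h' : G.obj (H.obj a) = K.obj (x.obj (endpoint true))) :
    (mapM H K w).obj (ofPath F a x h) = ofPath G (H.obj a) (x ⋙ K) h' :=
  M.ext_heq rfl rfl (heq_of_eq (by
    change K.map (x.map _ ≫ eqToHom h.symm) ≫ eqToHom (square_obj w a) =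
      K.map (x.map _) ≫ eqToHom h'.symm
    simp [eqToHom_map]))

end

/-- The cleavage of the functor of indiscrete groupoids induced by `f`, given by a section `g`
of `f`, and normal: an identity is lifted to an identity. -/
def indiscreteStr {T T' : Type u} [DecidableEq T'] (f : T → T') (g : T' → T) :
    M (functor (f ∘ Indiscrete.as) : Indiscrete T ⥤ Indiscrete T') ⥤ Indiscrete T :=
  functor fun m => if m.b.as = f m.a.as then m.a.as else g m.b.as

section

variable {T T' : Type u} [DecidableEq T'] (f : T → T') (g : T' → T)

theorem indiscreteStr_comp (hfg : ∀ t, f (g t) = t) :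
    indiscreteStr f g ⋙ functor (f ∘ Indiscrete.as) = R (functor (f ∘ Indiscrete.as)) := by
  refine functor_ext fun m => ?_
  change (⟨f (if _ then _ else _)⟩ : Indiscrete T') = ⟨m.b.as⟩
  split_ifs with h
  · rw [h]
  · rw [hfg]

theorem L_comp_indiscreteStr :
    L (functor (f ∘ Indiscrete.as)) ⋙ indiscreteStr f g = 𝟭 (Indiscrete T) :=
  functor_ext fun _ => congrArg Indiscrete.mk (if_pos rfl)

end

/-- The map from three to two points with two points over `true`. -/
def fold (t : Option (ULift.{u} Bool)) : ULift.{u} Bool := t.getD ⟨true⟩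

end IsoFact

open IsoFact Indiscrete PointedAlgebraFibre

/-! ### The cases of categories and groupoids -/

namespace CatR

instance isIso_unit_right (F : Arrow Cat.{u, u}) : IsIso (unit.app F).right :=
  inferInstanceAs (IsIso (𝟙 F.right))

/-- Lifting of isomorphisms for algebras over `Cat`. -/
def pathLifting : PathLifting unit.{u} where
  pt := Cat.of (Indiscrete PUnit)
  I := Cat.of Interval
  i₀ := (point (endpoint false)).toCatHom
  i₁ := (point (endpoint true)).toCatHom
  r := (functor fun _ => PUnit.unit).toCatHom
  i₁_r := rfl
  pathMk F e x h := (point (ofPath F.hom.toFunctor (e.toFunctor.obj ⟨⟨⟩⟩) x.toFunctor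
    (Functor.congr_obj (congrArg Cat.Hom.toFunctor h) ⟨⟨⟩⟩))).toCatHom
  pathMk_hom _ _ _ _ := Cat.Hom.ext (point_ext rfl)
  pathMk_map φ e x h h' := Cat.Hom.ext (point_ext (mapM_ofPath φ.left.toFunctor φ.right.toFunctor
    (congrArg Cat.Hom.toFunctor φ.w) (e.toFunctor.obj ⟨⟨⟩⟩) x.toFunctor
    (Functor.congr_obj (congrArg Cat.Hom.toFunctor h) ⟨⟨⟩⟩)
    (Functor.congr_obj (congrArg Cat.Hom.toFunctor h') ⟨⟨⟩⟩)))
  pathMk_const F e h := Cat.Hom.ext (point_ext (ofPath_const F.hom.toFunctor e.toFunctor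
    (Functor.congr_obj (congrArg Cat.Hom.toFunctor h) ⟨⟨⟩⟩)))

/-- The functor from the indiscrete groupoid on three objects to the interval, with a normal
cleavage. -/
noncomputable def foldAlgebra : (pointedAlgebraCod unit.{u}).Fiber (Cat.of Interval.{u}) :=
  ofStr (E := Cat.of (Indiscrete (Option (ULift.{u} Bool))))
    (functor (fold ∘ Indiscrete.as)).toCatHom (indiscreteStr fold some).toCatHom
    ((IsIso.eq_comp_inv _).2 (congrArg Functor.toCatHom (indiscreteStr_comp fold some fun _ => rfl)))
    (congrArg Functor.toCatHom (L_comp_indiscreteStr fold some))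

/-- The points `none` and `some true` both lie over `true`, and the cleavage carries both to `some
false`, the value of the section at `false`. -/
theorem not_isElementary : ¬ FibProd.IsElementary (pointedAlgebraCod unit.{u}) := by
  refine pathLifting.{u}.not_isElementary foldAlgebra (point ⟨none⟩).toCatHom
    (point ⟨some ⟨true⟩⟩).toCatHom (fun h => ?_) ?_ ?_ ?_
  · have h' := congrArg (fun f => (Indiscrete.as (f.toFunctor.obj ⟨⟨⟩⟩))) h
    exact Option.some_ne_none _ h'.symm
  · exact Cat.Hom.ext (point_ext rfl)
  · exact Cat.Hom.ext (point_ext rfl)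
  · exact Cat.Hom.ext (point_ext rfl)

end CatR

namespace GrpdR

instance isIso_unit_right (F : Arrow Grpd.{u, u}) : IsIso (unit.app F).right :=
  inferInstanceAs (IsIso (𝟙 F.right))

/-- This supplies the pullbacks and the terminal object for the general argument, by reflectivity of
groupoids in categories. -/
instance : HasLimits Grpd.{u, u} :=
  hasLimits_of_reflective Grpd.forgetToCat

/-- Lifting of isomorphisms for algebras over `Grpd`. -/
def pathLifting : PathLifting unit.{u} where
  pt := Grpd.of (Indiscrete PUnit)
  I := Grpd.of Interval
  i₀ := point (endpoint false)
  i₁ := point (endpoint true)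
  r := functor fun _ => PUnit.unit
  i₁_r := rfl
  pathMk F e x h := point (ofPath F.hom (e.obj ⟨⟨⟩⟩) x (Functor.congr_obj h ⟨⟨⟩⟩))
  pathMk_hom _ _ _ _ := point_ext rfl
  pathMk_map φ e x h h' := point_ext (mapM_ofPath φ.left φ.right φ.w (e.obj ⟨⟨⟩⟩) x
    (Functor.congr_obj h ⟨⟨⟩⟩) (Functor.congr_obj h' ⟨⟨⟩⟩))
  pathMk_const F e h := point_ext (ofPath_const F.hom e (Functor.congr_obj h ⟨⟨⟩⟩))

/-- The functor from the indiscrete groupoid on three objects to the interval, with a normal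
cleavage. -/
noncomputable def foldAlgebra : (pointedAlgebraCod unit.{u}).Fiber (Grpd.of Interval.{u}) :=
  ofStr (E := Grpd.of (Indiscrete (Option (ULift.{u} Bool)))) (X := Grpd.of Interval.{u})
    (functor (fold ∘ Indiscrete.as)) (indiscreteStr fold some)
    ((IsIso.eq_comp_inv _).2 (indiscreteStr_comp fold some fun _ => rfl))
    (L_comp_indiscreteStr fold some)

theorem not_isElementary : ¬ FibProd.IsElementary (pointedAlgebraCod unit.{u}) := by
  refine pathLifting.{u}.not_isElementary foldAlgebra (point (X := Indiscrete _) ⟨none⟩)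
    (point (X := Indiscrete _) ⟨some ⟨true⟩⟩) (fun h => ?_) ?_ ?_ ?_
  · have h' := congrArg Indiscrete.as (Functor.congr_obj h ⟨⟨⟩⟩)
    exact Option.some_ne_none _ h'.symm
  · exact point_ext rfl
  · exact point_ext rfl
  · exact point_ext rfl

end GrpdR

theorem corollary5p7 :
    (FibProd.IsFibrationWithProducts (pointedAlgebraCod CatR.unit.{u}) ∧
      ¬ FibProd.IsElementary (pointedAlgebraCod CatR.unit.{u})) ∧
    (FibProd.IsFibrationWithProducts (pointedAlgebraCod GrpdR.unit.{u}) ∧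
      ¬ FibProd.IsElementary (pointedAlgebraCod GrpdR.unit.{u})) :=
  ⟨⟨isFibrationWithProducts, CatR.not_isElementary⟩,
    ⟨isFibrationWithProducts, GrpdR.not_isElementary⟩⟩
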